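/- There are a program for a random access machine (uniform cost; arithmetic operations: addition and truncated subtraction of natural numbers) and a polynomial $b$ such that, for every interval graph $G$ with $n$ vertices (given by its adjacency matrix) and every integer $k\ge 0$, the program halts within $b(n)$ steps and correctly decides whether $TS_k(G)$ is connected. Here $TS_k(G)$ is the graph whose vertices are the independent sets of size $k$ of $G$, where $I$ and $J$ are adjacent if $J\setminus I=\{u\}$ and $I\setminus J=\{v\}$ for an edge $uv$ of $G$. This holds both with the convention that the graph without vertices is connected and with the convention that it is not. Moreover, let $G$ be a finite interval graph represented by segments $[l(v),r(v)]$ with pairwise distinct end points. For a vertex $u$, let $G_u$ be the subgraph induced by the vertices $v$ with $l(v)>r(u)$. Let $(\ell_1,\dots,\ell_\alpha)$ be the leftmost independent set of $G$: $\ell_1$ minimizes $r$ over $G$ and $\ell_{i+1}$ minimizes $r$ over $G_{\ell_i}$, as long as that graph has a vertex. Put $G_{\ell_0}=G$. For an induced subgraph $H$ of $G$ and a nonempty independent set $I$ of size $m$ of $H$, let $LM(I,H)$ be the vertex with the smallest $r$ among the leftmost vertices of the independent sets in the connected component of $I$ in $TS_m(H)$. For a vertex $a$ of $H$, let $w_l(a,m,H)$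 be the vertex with the largest $r$ among the vertices $LM(I,H)$, where $I$ ranges over the independent sets of size $m$ of $H$ with leftmost vertex $a$ ($w_l(a,m,H)$ is undefined if there is no such $I$). Then any two vertices of $TS_k(G)$ are joined by a path if and only if, for every $i\le \min(k,\alpha)$ and every vertex $a$ of $G_{\ell_i}$ for which $w_l(a,k-i,G_{\ell_i})$ is defined, $i<\alpha$ and $w_l(a,k-i,G_{\ell_i})=\ell_{i+1}$. -/

import Mathlib

namespace TokenSliding

/-! ### Token sliding -/

section Graphs

variable {V : Type*}

/-- The `k`-independent sets of `G`. -/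
abbrev IndepSets (G : SimpleGraph V) (k : ℕ) : Type _ :=
  {I : Finset V // G.IsNIndepSet k I}

/-- The reconfiguration graph `TS_k(G)`: its vertices are the `k`-independent sets of `G`, and
`I`, `J` are adjacent when `J \ I = {u}`, `I \ J = {v}` and `uv` is an edge of `G`. -/
def TS (G : SimpleGraph V) (k : ℕ) : SimpleGraph (IndepSets G k) where
  Adj I J := ∃ u v : V, (J.1 : Set V) \ (I.1 : Set V) = {u} ∧
    (I.1 : Set V) \ (J.1 : Set V) = {v} ∧ G.Adj u v
  symm := ⟨fun _ _ ⟨u, v, hu, hv, h⟩ => ⟨v, u, hv, hu, h.symm⟩⟩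
  loopless := ⟨fun _ ⟨_, _, hu, _, _⟩ => by
    rw [Set.sdiff_self] at hu
    exact Set.singleton_ne_empty _ hu.symm⟩

/-! ### Interval graphs -/

/-- A representation of `G` as the intersection graph of closed segments of the real line; `l v`
and `r v` are the left and the right extremity of the segment of the vertex `v`. -/
structure IntervalRep (G : SimpleGraph V) where
  l : V → ℝ
  r : V → ℝ
  l_le_r : ∀ v, l v ≤ r v
  adj_iff : ∀ u v, G.Adj u v ↔ u ≠ v ∧ (Set.Icc (l u) (r u) ∩ Set.Icc (l v) (r v)).Nonempty

/-- `G` is an interval graph. -/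
def IsIntervalGraph (G : SimpleGraph V) : Prop := Nonempty (IntervalRep G)

/-- All segments start and end at pairwise distinct points of the line. -/
def IntervalRep.Distinct {G : SimpleGraph V} (R : IntervalRep G) : Prop :=
  Function.Injective (Sum.elim R.l R.r)

/-- `LeftmostList l r S L`: `L` is the ordered leftmost independent set of the graph induced by
`S`. It is empty if `S` is empty; otherwise it is the vertex `u` of `S` that minimizes `r u`,
followed by the leftmost independent set of the vertices of `S` lying entirely to the right of
`u`. -/
inductive LeftmostList (l r : V → ℝ) : Set V → List V → Prop
  | nil : LeftmostList l r ∅ []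
  | cons (S : Set V) (u : V) (L : List V) : u ∈ S → (∀ v ∈ S, r u ≤ r v) →
      LeftmostList l r {v ∈ S | r u < l v} L → LeftmostList l r S (u :: L)

/-- Let `L = (ℓ_1, …, ℓ_α)`. For `1 ≤ i ≤ α` this is the vertex set of `G_{ℓ_i}`, i.e. the set of
all `v` with `r(ℓ_i) < l(v)`; for `i = 0` it is the whole vertex set. -/
def rightOf (l r : V → ℝ) (L : List V) : ℕ → Set V
  | 0 => Set.univ
  | i + 1 => {v | ∀ u, L[i]? = some u → r u < l v}

/-- `u` is the leftmost vertex `lm(I)` of `I`. -/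
def IsLeftmostVertex (r : V → ℝ) (I : Finset V) (u : V) : Prop :=
  u ∈ I ∧ ∀ v ∈ I, r u ≤ r v

/-- `x = LM(I, H)`: the vertex `x` is the minimum, for the order of right extremities, of `lm(J)`
over all `J` in the connected component of `I` in `TS_k(H)`. -/
def IsLM (H : SimpleGraph V) (r : V → ℝ) {k : ℕ} (I : IndepSets H k) (x : V) : Prop :=
  (∃ J, (TS H k).Reachable I J ∧ IsLeftmostVertex r J.1 x) ∧
    ∀ J y, (TS H k).Reachable I J → IsLeftmostVertex r J.1 y → r x ≤ r y

/-- `x = w_l(u, k, H)`, the worst l-index of `u`: the vertex `x` is the maximum, for the order of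
right extremities, of `LM(I, H)` over all `k`-independent sets `I` of `H` with leftmost vertex `u`.
No `x` satisfies this if there is no such `I`. -/
def IsWorstL (H : SimpleGraph V) (r : V → ℝ) (k : ℕ) (u x : V) : Prop :=
  (∃ I : IndepSets H k, IsLeftmostVertex r I.1 u ∧ IsLM H r I x) ∧
    ∀ (I : IndepSets H k) (y : V), IsLeftmostVertex r I.1 u → IsLM H r I y → r y ≤ r x

end Graphs

/-! ### A random access machine with uniform cost

Programs are written in structured form. They use variables and arrays (of unbounded length)
holding natural numbers. The names of variables and arrays are constants of the program, so that
a program uses finitely many of them; the index of an array cell is computed. The arithmetic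
operations are addition and truncated subtraction only. As there is no multiplication, uniform cost
is polynomially equivalent to the running time of a Turing machine. -/

/-- A state of the memory. -/
structure State where
  var : ℕ → ℕ
  arr : ℕ → ℕ → ℕ

/-- Expressions. -/
inductive Expr
  | lit (c : ℕ)
  | var (x : ℕ)
  | read (a : ℕ) (i : Expr)
  | add (e f : Expr)
  | sub (e f : Expr)

/-- The value of an expression. -/
def Expr.eval (s : State) : Expr → ℕ
  | lit c => c
  | var x => s.var x
  | read a i => s.arr a (i.eval s)
  | add e f => e.eval s + f.eval s
  | sub e f => e.eval s - f.eval s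

/-- The number of steps needed to evaluate an expression: one for each constant, variable, array
access and operation. -/
def Expr.cost : Expr → ℕ
  | lit _ => 1
  | var _ => 1
  | read _ i => i.cost + 1
  | add e f => e.cost + f.cost + 1
  | sub e f => e.cost + f.cost + 1

/-- Programs. A test `e` succeeds if the value of `e` is not `0`. -/
inductive Prog
  | skip
  | assign (x : ℕ) (e : Expr)
  | write (a : ℕ) (i e : Expr)
  | seq (p q : Prog)
  | cond (e : Expr) (p q : Prog)
  | loop (e : Expr) (p : Prog)

/-- `Runs p s t s'`: started in the state `s`, the program `p` halts after exactly `t` steps in the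
state `s'`. -/
inductive Runs : Prog → State → ℕ → State → Prop
  | skip (s : State) : Runs Prog.skip s 1 s
  | assign (s : State) (x : ℕ) (e : Expr) :
      Runs (Prog.assign x e) s (e.cost + 1) ⟨Function.update s.var x (e.eval s), s.arr⟩
  | write (s : State) (a : ℕ) (i e : Expr) :
      Runs (Prog.write a i e) s (i.cost + e.cost + 1)
        ⟨s.var, Function.update s.arr a (Function.update (s.arr a) (i.eval s) (e.eval s))⟩
  | seq {p q : Prog} {s s' s'' : State} {t t' : ℕ} :
      Runs p s t s' → Runs q s' t' s'' → Runs (Prog.seq p q) s (t + t') s''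
  | cond_true {e : Expr} {p q : Prog} {s s' : State} {t : ℕ} :
      e.eval s ≠ 0 → Runs p s t s' → Runs (Prog.cond e p q) s (e.cost + 1 + t) s'
  | cond_false {e : Expr} {p q : Prog} {s s' : State} {t : ℕ} :
      e.eval s = 0 → Runs q s t s' → Runs (Prog.cond e p q) s (e.cost + 1 + t) s'
  | loop_done {e : Expr} {p : Prog} {s : State} :
      e.eval s = 0 → Runs (Prog.loop e p) s (e.cost + 1) s
  | loop_step {e : Expr} {p : Prog} {s s' s'' : State} {t t' : ℕ} :
      e.eval s ≠ 0 → Runs p s t s' → Runs (Prog.loop e p) s' t' s'' →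
        Runs (Prog.loop e p) s (e.cost + 1 + t + t') s''

open scoped Classical in
/-- The initial memory for a graph `G` on `{0, …, n - 1}` and a number `k`: variable `0` holds `n`,
variable `1` holds `k`, array `0` holds the adjacency matrix of `G` row by row (the entry for
`(u, v)` in cell `u * n + v`), and everything else is `0`. -/
noncomputable def input {n : ℕ} (G : SimpleGraph (Fin n)) (k : ℕ) : State where
  var x := if x = 0 then n else if x = 1 then k else 0
  arr a i := if a = 0 ∧ ∃ u v : Fin n, i = u.val * n + v.val ∧ G.Adj u v then 1 else 0

/-- For the graphs `G` in the class `C` and all `k`, the property `P` of `(G, k)` can be decided in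
time polynomial in the number `n` of vertices: one program halts on every such input within
`b(n)` steps, for one fixed polynomial `b`, with the answer (`1` for yes and `0` for no) in
variable `0`. -/
def DecidableInPolyTime (C : ∀ n : ℕ, SimpleGraph (Fin n) → Prop)
    (P : ∀ n : ℕ, SimpleGraph (Fin n) → ℕ → Prop) : Prop :=
  ∃ (p : Prog) (b : Polynomial ℕ), ∀ (n : ℕ) (G : SimpleGraph (Fin n)) (k : ℕ), C n G →
    ∃ (t : ℕ) (s : State), Runs p (input G k) t s ∧ t ≤ b.eval n ∧
      (P n G k → s.var 0 = 1) ∧ (¬ P n G k → s.var 0 = 0)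

end TokenSliding

namespace TokenSliding

/-! ### Total correctness with a time bound -/

/-- Started in `s`, the program `p` halts within `T` steps in a state that satisfies `Q`. -/
def Total (p : Prog) (s : State) (T : ℕ) (Q : State → Prop) : Prop :=
  ∃ t s', Runs p s t s' ∧ t ≤ T ∧ Q s'

/-- The state in which variable `x` has been set to `v`. -/
def State.set (s : State) (x v : ℕ) : State := ⟨Function.update s.var x v, s.arr⟩

@[simp] theorem State.set_arr (s : State) (x v : ℕ) : (s.set x v).arr = s.arr := rfl

theorem State.set_var (s : State) (x v y : ℕ) :
    (s.set x v).var y = if y = x then v else s.var y := by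
  simp [State.set, Function.update_apply]

@[simp] theorem State.set_var_same (s : State) (x v : ℕ) : (s.set x v).var x = v := by
  simp [State.set_var]

theorem State.set_var_of_ne (s : State) {x y : ℕ} (v : ℕ) (h : y ≠ x) :
    (s.set x v).var y = s.var y := by
  simp [State.set_var, h]

theorem Total.mono {p : Prog} {s : State} {T T' : ℕ} {Q Q' : State → Prop}
    (h : Total p s T Q) (hT : T ≤ T') (hQ : ∀ s', Q s' → Q' s') : Total p s T' Q' := by
  obtain ⟨t, s', hr, ht, hq⟩ := h
  exact ⟨t, s', hr, ht.trans hT, hQ _ hq⟩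

/-- The postcondition of the first program is the correctness of the second, so that a proof can run
forwards through a program without naming intermediate assertions. -/
theorem Total.seq {p q : Prog} {s : State} {T T' : ℕ} {Q : State → Prop}
    (h : Total p s T fun s' => Total q s' T' Q) : Total (Prog.seq p q) s (T + T') Q := by
  obtain ⟨t, s', hr, ht, t', s'', hr', ht', hq⟩ := h
  exact ⟨t + t', s'', Runs.seq hr hr', by omega, hq⟩

theorem Total.assign {s : State} {x : ℕ} {e : Expr} {Q : State → Prop}
    (h : Q (s.set x (e.eval s))) : Total (Prog.assign x e) s (e.cost + 1) Q :=
  ⟨_, _, Runs.assign s x e, le_rfl, h⟩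

theorem Total.write {s : State} {a : ℕ} {i e : Expr} {Q : State → Prop}
    (h : Q ⟨s.var, Function.update s.arr a
      (Function.update (s.arr a) (i.eval s) (e.eval s))⟩) :
    Total (Prog.write a i e) s (i.cost + e.cost + 1) Q :=
  ⟨_, _, Runs.write s a i e, le_rfl, h⟩

theorem Total.skip {s : State} {Q : State → Prop} (h : Q s) : Total Prog.skip s 1 Q :=
  ⟨_, _, Runs.skip s, le_rfl, h⟩

theorem Total.cond {s : State} {e : Expr} {p q : Prog} {T : ℕ} {Q : State → Prop}
    (h₁ : e.eval s ≠ 0 → Total p s T Q) (h₂ : e.eval s = 0 → Total q s T Q) :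
    Total (Prog.cond e p q) s (e.cost + 1 + T) Q := by
  by_cases h : e.eval s = 0
  · obtain ⟨t, s', hr, ht, hq⟩ := h₂ h
    exact ⟨_, s', Runs.cond_false h hr, by omega, hq⟩
  · obtain ⟨t, s', hr, ht, hq⟩ := h₁ h
    exact ⟨_, s', Runs.cond_true h hr, by omega, hq⟩

/-- A loop whose test decreases at every round. -/
theorem Total.loop {e : Expr} {p : Prog} {T : ℕ} {Q : State → Prop} (Inv : ℕ → State → Prop)
    (done : ∀ s, Inv 0 s → e.eval s = 0 ∧ Q s)
    (step : ∀ m s, Inv (m + 1) s → (e.eval s = 0 ∧ Q s) ∨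
      (e.eval s ≠ 0 ∧ Total p s T (Inv m))) :
    ∀ m s, Inv m s → Total (Prog.loop e p) s (e.cost + 1 + m * (e.cost + 1 + T)) Q := by
  intro m
  induction m with
  | zero =>
    intro s hs
    exact ⟨_, _, Runs.loop_done (done s hs).1, by omega, (done s hs).2⟩
  | succ m ih =>
    intro s hs
    rcases step m s hs with ⟨h0, hq⟩ | ⟨h0, t, s', hr, ht, hi⟩
    · exact ⟨_, _, Runs.loop_done h0, by omega, hq⟩
    · obtain ⟨t', s'', hr', ht', hq⟩ := ih s' hi
      refine ⟨_, s'', Runs.loop_step h0 hr hr', ?_, hq⟩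
      rw [Nat.succ_mul]
      omega

/-- `for x := 0, …, m - 1 do p`, where the bound is the value of variable `m`. -/
def Prog.forBelow (x m : ℕ) (p : Prog) : Prog :=
  Prog.seq (Prog.assign x (Expr.lit 0))
    (Prog.loop (Expr.sub (Expr.var m) (Expr.var x))
      (Prog.seq p (Prog.assign x (Expr.add (Expr.var x) (Expr.lit 1)))))

/-- The body has to preserve the counter, and the next invariant is required after the increment.
The bound is read again in every round, hence the condition that the invariant fixes variable `m`.
-/
theorem Total.forLoop {x m M : ℕ} {p : Prog} {T : ℕ} {s : State} (Inv : ℕ → State → Prop)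
    (bound : ∀ v s, Inv v s → s.var m = M) (start : Inv 0 (s.set x 0))
    (step : ∀ v < M, ∀ s, s.var x = v → Inv v s →
      Total p s T fun s' => s'.var x = v ∧ Inv (v + 1) (s'.set x (v + 1))) :
    Total (Prog.forBelow x m p) s (6 + M * (T + 8)) (Inv M) := by
  have key := Total.loop (e := Expr.sub (Expr.var m) (Expr.var x))
    (p := Prog.seq p (Prog.assign x (Expr.add (Expr.var x) (Expr.lit 1))))
    (T := T + 4) (Q := Inv M)
    -- The index of `Total.loop` counts the rounds that remain, so the counter is `M - j`.
    (fun j s => j ≤ M ∧ s.var x = M - j ∧ Inv (M - j) s)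
    (fun s hs => by
      have := bound _ _ hs.2.2
      refine ⟨?_, by simpa using hs.2.2⟩
      simp [Expr.eval, hs.2.1, this])
    (fun j s hs => by
      right
      have hb := bound _ _ hs.2.2
      refine ⟨?_, ?_⟩
      · simp only [Expr.eval, hs.2.1, hb]
        omega
      · refine Total.seq ((step (M - (j + 1)) (by omega) s hs.2.1 hs.2.2).mono le_rfl ?_)
        rintro s' ⟨h1, h2⟩
        refine Total.assign ⟨by omega, ?_⟩
        have e1 : M - (j + 1) + 1 = M - j := by omega
        simp only [Expr.eval, h1]
        rw [e1] at h2 ⊢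
        exact ⟨by simp, h2⟩)
    M (s.set x 0) ⟨le_rfl, by simp, by simpa using start⟩
  refine (Total.seq (T := 2) (Total.assign (by simpa [Expr.eval] using key))).mono ?_
    fun _ h => h
  simp only [Expr.cost]
  have : M * (1 + 1 + 1 + 1 + (T + 4)) = M * (T + 8) := by congr 1; omega
  omega

/-- Iterating a program that advances an invariant by `a`. -/
theorem Total.forLoop_iterate {x m M a : ℕ} {p : Prog} {T : ℕ} (Inv : ℕ → State → Prop)
    (bound : ∀ v s, Inv v s → s.var m = M)
    (insens : ∀ v s c, Inv v s → Inv v (s.set x c))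
    (step : ∀ v s, Inv v s → Total p s T fun s' =>
      (∀ i ≤ x, i ≠ 2 → s'.var i = s.var i) ∧ Inv (v + a) s')
    (hx2 : x ≠ 2) (v : ℕ) (s : State) (hs : Inv v s) :
    Total (Prog.forBelow x m p) s (6 + M * (T + 8)) fun s' =>
      (∀ i < x, i ≠ 2 → s'.var i = s.var i) ∧ Inv (v + M * a) s' := by
  refine Total.forLoop (M := M)
    (fun j s' => (∀ i < x, i ≠ 2 → s'.var i = s.var i) ∧ Inv (v + j * a) s')
    (fun _ _ h => bound _ _ h.2)
    ⟨fun i hi _ => State.set_var_of_ne _ _ (by omega), by simpa using insens _ _ _ hs⟩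
    fun j _ s₁ hj hs₁ => (step _ s₁ hs₁.2).mono le_rfl ?_
  rintro s₂ ⟨h1, h2⟩
  refine ⟨by rw [h1 x le_rfl hx2, hj], fun i hi h => ?_, ?_⟩
  · rw [State.set_var_of_ne _ _ (by omega), h1 i hi.le h, hs₁.1 i hi h]
  · rw [Nat.succ_mul, ← add_assoc]
    exact insens _ _ _ h2

/-! ### Compilation of first-order formulas -/

/-- First-order formulas; quantifiers range over the numbers below the value of variable `3`. -/
inductive Form
  | test (e : Expr)
  | neg (φ : Form)
  | and (φ ψ : Form)
  | ex (x : ℕ) (φ : Form)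

namespace Form

/-- Truth of a formula in a state. -/
def Sat : Form → State → Prop
  | test e, s => e.eval s ≠ 0
  | neg φ, s => ¬ φ.Sat s
  | and φ ψ, s => φ.Sat s ∧ ψ.Sat s
  | ex x φ, s => ∃ v < s.var 3, φ.Sat (s.set x v)

/-- A program that computes the truth value of a formula in variable `2`. -/
def comp : Form → Prog
  | test e => Prog.cond e (Prog.assign 2 (Expr.lit 1)) (Prog.assign 2 (Expr.lit 0))
  | neg φ => Prog.seq φ.comp (Prog.assign 2 (Expr.sub (Expr.lit 1) (Expr.var 2)))
  | and φ ψ => Prog.seq φ.comp (Prog.cond (Expr.var 2) ψ.comp Prog.skip)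
  | ex x φ => Prog.seq (Prog.assign x (Expr.lit 0)) (Prog.seq (Prog.assign 2 (Expr.lit 0))
      (Prog.loop (Expr.sub (Expr.var 3) (Expr.var x))
        (Prog.seq φ.comp (Prog.cond (Expr.var 2) (Prog.assign x (Expr.var 3))
          (Prog.assign x (Expr.add (Expr.var x) (Expr.lit 1)))))))

/-- A bound for the running time of `comp` if variable `3` has value `N`. -/
def time : Form → ℕ → ℕ
  | test e, _ => e.cost + 3
  | neg φ, N => φ.time N + 4
  | and φ ψ, N => φ.time N + ψ.time N + 3
  | ex _ φ, N => 8 + N * (φ.time N + 10)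

end Form

/-- The expression reads only variables below `d`, except `2`, and does not read array `b`. -/
def Expr.Scoped (d b : ℕ) : Expr → Bool
  | lit _ => true
  | var x => x < d && x != 2
  | read a i => a != b && i.Scoped d b
  | add e f => e.Scoped d b && f.Scoped d b
  | sub e f => e.Scoped d b && f.Scoped d b

/-- All variables are below `d`, except those bound by quantifiers, which are numbered
consecutively from `d` on. Array `b` is not read. -/
def Form.Scoped (b : ℕ) : ℕ → Form → Bool
  | d, test e => e.Scoped d b
  | d, neg φ => φ.Scoped b d
  | d, and φ ψ => φ.Scoped b d && ψ.Scoped b d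
  | d, ex x φ => x == d && φ.Scoped b (d + 1)

/-- The states agree on all variables below `d`, except `2`, and on all arrays except `b`. -/
def Agree (d b : ℕ) (s s' : State) : Prop :=
  (∀ i < d, i ≠ 2 → s'.var i = s.var i) ∧ ∀ a, a ≠ b → s'.arr a = s.arr a

theorem Agree.refl (d b : ℕ) (s : State) : Agree d b s s := ⟨fun _ _ _ => rfl, fun _ _ => rfl⟩

theorem Agree.trans {d b : ℕ} {s s' s'' : State} (h : Agree d b s s') (h' : Agree d b s' s'') :
    Agree d b s s'' :=
  ⟨fun i hi h2 => (h'.1 i hi h2).trans (h.1 i hi h2), fun a ha => (h'.2 a ha).trans (h.2 a ha)⟩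

theorem Agree.of_le {d d' b : ℕ} {s s' : State} (h : Agree d b s s') (hd : d' ≤ d) :
    Agree d' b s s' :=
  ⟨fun i hi => h.1 i (hi.trans_le hd), h.2⟩

theorem Agree.set_right {d b : ℕ} {s s' : State} (h : Agree d b s s') {x : ℕ} (hx : d ≤ x ∨ x = 2)
    (v : ℕ) : Agree d b s (s'.set x v) :=
  ⟨fun i hi h2 => by rw [State.set_var_of_ne _ _ (by omega), h.1 i hi h2], h.2⟩

theorem Agree.set_both {d b : ℕ} {s s' : State} (h : Agree d b s s') (v : ℕ) :
    Agree (d + 1) b (s.set d v) (s'.set d v) :=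
  ⟨fun i hi h2 => by
    by_cases e : i = d
    · simp [e]
    · rw [State.set_var_of_ne _ _ e, State.set_var_of_ne _ _ e, h.1 i (by omega) h2], h.2⟩

theorem Expr.eval_congr {d b : ℕ} {s s' : State} (h : Agree d b s s') (e : Expr)
    (he : e.Scoped d b) : e.eval s' = e.eval s := by
  induction e with
  | lit => rfl
  | var x =>
    simp only [Scoped, Bool.and_eq_true, decide_eq_true_eq, bne_iff_ne] at he
    exact h.1 x he.1 he.2
  | read a i ih =>
    simp only [Scoped, Bool.and_eq_true, bne_iff_ne] at he
    simp only [eval, ih he.2, h.2 a he.1]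
  | add e f ihe ihf =>
    simp only [Scoped, Bool.and_eq_true] at he
    simp only [eval, ihe he.1, ihf he.2]
  | sub e f ihe ihf =>
    simp only [Scoped, Bool.and_eq_true] at he
    simp only [eval, ihe he.1, ihf he.2]

/-- Evaluation overwrites only variable `2` and bound variables, which are numbered from `d` on. By
this lemma such changes do not affect the truth of a formula that is evaluated afterwards. -/
theorem Form.sat_congr {b : ℕ} (φ : Form) {d : ℕ} {s s' : State} (hd : 3 < d)
    (h : Agree d b s s') (hφ : φ.Scoped b d) : φ.Sat s' ↔ φ.Sat s := by
  induction φ generalizing d s s' with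
  | test e => simp only [Sat, Expr.eval_congr h e hφ]
  | neg φ ih => simp only [Sat, ih hd h hφ]
  | and φ ψ ih₁ ih₂ =>
    simp only [Scoped, Bool.and_eq_true] at hφ
    simp only [Sat, ih₁ hd h hφ.1, ih₂ hd h hφ.2]
  | ex x φ ih =>
    simp only [Scoped, Bool.and_eq_true, beq_iff_eq] at hφ
    obtain ⟨rfl, hφ⟩ := hφ
    simp only [Sat, h.1 3 hd (by decide)]
    refine exists_congr fun v => and_congr_right fun _ => ?_
    exact ih (by omega) (h.set_both v) hφ

open scoped Classical in
/-- The program `φ.comp` computes the truth value of `φ`. -/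
theorem Form.comp_total {b : ℕ} (φ : Form) {d N : ℕ} {s : State} (hd : 3 < d)
    (hφ : φ.Scoped b d) (hN : s.var 3 = N) :
    Total φ.comp s (φ.time N) fun s' => s'.arr = s.arr ∧
      (∀ i < d, i ≠ 2 → s'.var i = s.var i) ∧ s'.var 2 = if φ.Sat s then 1 else 0 := by
  induction φ generalizing d s with
  | test e =>
    refine (Total.cond (T := 2) (fun h => Total.assign ?_) fun h => Total.assign ?_).mono
      (by simp only [time]; omega) fun _ h => h
    · exact ⟨rfl, fun i _ h2 => State.set_var_of_ne _ _ h2, by simp [Sat, h, Expr.eval]⟩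
    · exact ⟨rfl, fun i _ h2 => State.set_var_of_ne _ _ h2, by simp [Sat, h, Expr.eval]⟩
  | neg φ ih =>
    refine (Total.seq (T' := 4) ((ih hd hφ hN).mono le_rfl ?_)).mono (by simp [time])
      fun _ h => h
    rintro s' ⟨h1, h2, h3⟩
    refine Total.assign ⟨h1, fun i hi hi2 => ?_, ?_⟩
    · rw [State.set_var_of_ne _ _ hi2, h2 i hi hi2]
    · by_cases h : φ.Sat s <;> simp [Sat, Expr.eval, h3, h]
  | and φ ψ ih₁ ih₂ =>
    simp only [Scoped, Bool.and_eq_true] at hφ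
    refine (Total.seq (T' := ψ.time N + 3) ((ih₁ hd hφ.1 hN).mono le_rfl ?_)).mono
      (by simp [time]; omega) fun _ h => h
    rintro s' ⟨h1, h2, h3⟩
    refine (Total.cond (T := ψ.time N + 1) (fun h => ?_) fun h => ?_).mono
      (by simp only [Expr.cost]; omega) fun _ h => h
    · refine (ih₂ hd hφ.2 (by rw [h2 3 hd (by decide), hN])).mono (by omega) ?_
      rintro s'' ⟨h1', h2', h3'⟩
      refine ⟨h1'.trans h1, fun i hi hi2 => (h2' i hi hi2).trans (h2 i hi hi2), ?_⟩
      have hS : φ.Sat s := by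
        by_contra hc
        simp [Expr.eval, h3, hc] at h
      rw [h3', ψ.sat_congr (b := b) hd ⟨h2, fun a _ => by rw [h1]⟩ hφ.2]
      simp [Sat, hS]
    · refine (Total.skip ?_).mono (Nat.le_add_left _ _) fun _ h => h
      refine ⟨h1, h2, ?_⟩
      have hS : ¬ φ.Sat s := by
        intro hc
        simp [Expr.eval, h3, hc] at h
      simp [h3, Sat, hS]
  | ex x φ ih =>
    simp only [Scoped, Bool.and_eq_true, beq_iff_eq] at hφ
    obtain ⟨rfl, hφ⟩ := hφ
    let P (v : ℕ) : Prop := φ.Sat (s.set x v)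
    have key := Total.loop (e := Expr.sub (Expr.var 3) (Expr.var x))
      (p := Prog.seq φ.comp (Prog.cond (Expr.var 2) (Prog.assign x (Expr.var 3))
          (Prog.assign x (Expr.add (Expr.var x) (Expr.lit 1)))))
      (T := φ.time N + 6)
      (Q := fun s' => s'.arr = s.arr ∧ (∀ i < x, i ≠ 2 → s'.var i = s.var i) ∧
        s'.var 2 = if (Form.ex x φ).Sat s then 1 else 0)
      -- Either a witness has been found and the counter has jumped to `N`, which ends the loop
      -- early, or all values below the counter have been refuted.
      (fun j s' => s'.arr = s.arr ∧ (∀ i < x, i ≠ 2 → s'.var i = s.var i) ∧ j ≤ N ∧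
        ((s'.var x = N ∧ s'.var 2 = 1 ∧ ∃ v < N, P v) ∨
          (s'.var x = N - j ∧ s'.var 2 = 0 ∧ ∀ v < N - j, ¬ P v)))
      (fun s' ⟨h1, h2, _, h3⟩ => by
        have hN' : s'.var 3 = N := by rw [h2 3 hd (by decide), hN]
        rcases h3 with ⟨h3, h4, h5⟩ | ⟨h3, h4, h5⟩
        · refine ⟨by simp [Expr.eval, h3, hN'], h1, h2, ?_⟩
          rw [h4, if_pos]
          exact h5.imp fun v hv => ⟨hN.symm ▸ hv.1, hv.2⟩
        · refine ⟨by simp [Expr.eval, h3, hN'], h1, h2, ?_⟩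
          rw [h4, if_neg]
          rintro ⟨v, hv, hv'⟩
          exact h5 v (by omega) hv')
      (fun j s' ⟨h1, h2, hj, h3⟩ => by
        have hN' : s'.var 3 = N := by rw [h2 3 hd (by decide), hN]
        rcases h3 with ⟨h3, h4, h5⟩ | ⟨h3, h4, h5⟩
        · left
          refine ⟨by simp [Expr.eval, h3, hN'], h1, h2, ?_⟩
          rw [h4, if_pos]
          exact h5.imp fun v hv => ⟨hN.symm ▸ hv.1, hv.2⟩
        · right
          refine ⟨by simp only [Expr.eval, h3, hN']; omega, ?_⟩
          refine Total.seq ((ih (d := x + 1) (by omega) hφ hN').mono le_rfl ?_)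
          rintro s'' ⟨g1, g2, g3⟩
          have hP : φ.Sat s' ↔ P (N - (j + 1)) := by
            refine φ.sat_congr (b := b) (by omega) ⟨fun i hi hi2 => ?_, fun a _ => ?_⟩ hφ
            · by_cases e : i = x
              · subst e
                rw [h3]
                simp
              · rw [State.set_var_of_ne _ _ e, h2 i (by omega) hi2]
            · rw [h1]; rfl
          refine (Total.cond (T := 4) (fun h => (Total.assign ?_).mono (by simp [Expr.cost])
            fun _ h => h) fun h => (Total.assign ?_).mono (by simp [Expr.cost])
            fun _ h => h).mono (by simp [Expr.cost]) fun _ h => h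
          · have hS : φ.Sat s' := by
              by_contra hc
              simp [Expr.eval, g3, hc] at h
            refine ⟨g1.trans h1, fun i hi hi2 => ?_, by omega, Or.inl ⟨?_, ?_, ?_⟩⟩
            · rw [State.set_var_of_ne _ _ (by omega), g2 i (by omega) hi2, h2 i hi hi2]
            · simp only [Expr.eval, State.set_var_same]
              rw [g2 3 (by omega) (by decide), hN']
            · rw [State.set_var_of_ne _ _ (by omega), g3, if_pos hS]
            · exact ⟨_, by omega, hP.1 hS⟩
          · have hS : ¬ φ.Sat s' := by
              intro hc
              simp [Expr.eval, g3, hc] at h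
            refine ⟨g1.trans h1, fun i hi hi2 => ?_, by omega, Or.inr ⟨?_, ?_, ?_⟩⟩
            · rw [State.set_var_of_ne _ _ (by omega), g2 i (by omega) hi2, h2 i hi hi2]
            · simp only [Expr.eval, State.set_var_same]
              rw [g2 x (by omega) (by omega), h3]
              omega
            · rw [State.set_var_of_ne _ _ (by omega), g3, if_neg hS]
            · intro v hv
              by_cases e : v = N - (j + 1)
              · rw [e]
                exact fun h => hS (hP.2 h)
              · exact h5 v (by omega))
      N ((s.set x 0).set 2 0) ⟨rfl, fun i hi hi2 => by
        rw [State.set_var_of_ne _ _ hi2, State.set_var_of_ne _ _ (by omega)], le_rfl,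
        Or.inr ⟨by rw [State.set_var_of_ne _ _ (by omega)]; simp, by simp, by simp⟩⟩
    refine (Total.seq (T := 2) (Total.assign (Total.seq (T := 2)
      (Total.assign (by simpa [Expr.eval] using key))))).mono ?_ fun _ h => h
    simp only [Expr.cost, time]
    have : N * (1 + 1 + 1 + 1 + (φ.time N + 6)) = N * (φ.time N + 10) := by congr 1; omega
    omega

/-! ### Tables -/

/-- `s'` arises from `s` by overwriting array `b` on the set `I` with the values of `F`; apart from
that only variable `2` and the variables from `d` on may have changed. -/
def Overwrites (d b : ℕ) (I : Set ℕ) (F : ℕ → ℕ) (s s' : State) : Prop :=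
  Agree d b s s' ∧ (∀ i ∈ I, s'.arr b i = F i) ∧ ∀ i ∉ I, s'.arr b i = s.arr b i

/-- All values written come from one function `F`, so a cell that is hit in several rounds still
ends with the right value, and the sets `I v` need not be disjoint. -/
theorem Total.forLoop_overwrites {d b N T : ℕ} {p : Prog} {s : State} (hd : 3 < d)
    (I : ℕ → Set ℕ) (F : ℕ → ℕ) (hN : s.var 3 = N)
    (body : ∀ v < N, ∀ s₁, Agree d b s s₁ → s₁.var d = v →
      Total p s₁ T (Overwrites (d + 1) b (I v) F s₁)) :
    Total (Prog.forBelow d 3 p) s (6 + N * (T + 8))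
      (Overwrites d b {i | ∃ v < N, i ∈ I v} F s) := by
  refine Total.forLoop (M := N)
    (fun m => Overwrites d b {i | ∃ v < m, i ∈ I v} F s)
    (fun v s₁ h => by rw [h.1.1 3 hd (by decide), hN])
    ⟨(Agree.refl d b s).set_right (Or.inl le_rfl) _, by simp, fun i _ => rfl⟩ ?_
  rintro v hv s₁ hs₁ ⟨h1, h2, h3⟩
  refine (body v hv s₁ h1 hs₁).mono le_rfl ?_
  rintro s₂ ⟨g1, g2, g3⟩
  refine ⟨by rw [g1.1 d (by omega) (by omega), hs₁],
    (h1.trans (g1.of_le (by omega))).set_right (Or.inl le_rfl) _, ?_, ?_⟩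
  · rintro i ⟨u, hu, hi⟩
    change s₂.arr b i = F i
    by_cases hv' : i ∈ I v
    · exact g2 i hv'
    · rw [g3 i hv']
      have : u ≠ v := fun e => hv' (e ▸ hi)
      exact h2 i ⟨u, by omega, hi⟩
  · intro i hi
    change s₂.arr b i = s.arr b i
    rw [g3 i fun h => hi ⟨v, by omega, h⟩]
    exact h3 i fun ⟨u, hu, h⟩ => hi ⟨u, by omega, h⟩

/-- The index of the quadruple stored in the variables `x`, `y`, `z`, `w`; array `1` serves as
multiplication table. -/
def quad (x y z w : ℕ) : Expr :=
  .add (.read 1 (.add (.read 1 (.add (.read 1 (.var x)) (.var y))) (.var z))) (.var w)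

/-- Positional notation in base `N`. -/
def code (N x y z w : ℕ) : ℕ := ((x * N + y) * N + z) * N + w

/-- Successive division by `N` recovers the digits; the leading digit is what remains and needs no
bound. -/
theorem code_inj {N x y z w x' y' z' w' : ℕ} (hy : y < N) (hz : z < N) (hw : w < N)
    (hy' : y' < N) (hz' : z' < N) (hw' : w' < N) (h : code N x y z w = code N x' y' z' w') :
    x = x' ∧ y = y' ∧ z = z' ∧ w = w' := by
  have aux : ∀ {a b c d : ℕ}, b < N → d < N → b + N * a = d + N * c → a = c ∧ b = d := by
    intro a b c d hb hd h
    have h1 : (b + N * a) % N = (d + N * c) % N := by rw [h]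
    rw [Nat.add_mul_mod_self_left, Nat.add_mul_mod_self_left, Nat.mod_eq_of_lt hb,
      Nat.mod_eq_of_lt hd] at h1
    subst h1
    exact ⟨Nat.eq_of_mul_eq_mul_left (by omega) (Nat.add_left_cancel h), rfl⟩
  simp only [code, mul_comm _ N, add_comm (N * _)] at h
  obtain ⟨h₁, ew⟩ := aux hw hw' h
  obtain ⟨h₂, ez⟩ := aux hz hz' h₁
  obtain ⟨h₃, ey⟩ := aux hy hy' h₂
  exact ⟨h₃, ey, ez, ew⟩

/-- Variable `3` holds `N`, and array `1` holds the multiples of `N`. -/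
def Ready (N : ℕ) (s : State) : Prop := s.var 3 = N ∧ ∀ i < N * N * N, s.arr 1 i = i * N

theorem Ready.of_agree {N d b : ℕ} {s s' : State} (h : Ready N s) (hd : 3 < d) (hb : b ≠ 1)
    (ha : Agree d b s s') : Ready N s' :=
  ⟨by rw [ha.1 3 hd (by decide), h.1], fun i hi => by rw [ha.2 1 hb.symm, h.2 i hi]⟩

/-- The quadruple `(x, y, z, w)` belongs to the relation stored in array `b`. -/
def Tab (s : State) (b x y z w : ℕ) : Prop :=
  s.arr b (s.arr 1 (s.arr 1 (s.arr 1 x + y) + z) + w) ≠ 0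

/-- Horner's scheme multiplies only numbers with at most three digits in base `N`, so a table of
multiples of length `N * N * N` suffices. -/
theorem Ready.index_eq {N : ℕ} {s : State} (h : Ready N s) {x y z : ℕ} (w : ℕ) (hx : x < N)
    (hy : y < N) (hz : z < N) :
    s.arr 1 (s.arr 1 (s.arr 1 x + y) + z) + w = code N x y z w := by
  have h1 : x * N + y < N * N := by nlinarith
  have h2 : (x * N + y) * N + z < N * N * N := by nlinarith
  have h0 : x < N * N * N := by nlinarith [Nat.zero_le (x * N)]
  have h1' : x * N + y < N * N * N := by nlinarith
  rw [h.2 _ h0, h.2 _ h1', h.2 _ h2, code]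

/-- Store the relation defined by `φ` in the variables `10`, `11`, `12`, `13` in array `b`. -/
def fill (b : ℕ) (φ : Form) : Prog :=
  Prog.forBelow 10 3 (Prog.forBelow 11 3 (Prog.forBelow 12 3 (Prog.forBelow 13 3
    (Prog.seq φ.comp (Prog.write b (quad 10 11 12 13) (Expr.var 2))))))

/-- A bound for the running time of `fill`. -/
def fillTime (φ : Form) (N : ℕ) : ℕ :=
  6 + N * (6 + N * (6 + N * (6 + N * (φ.time N + 20 + 8) + 8) + 8) + 8)

/-- The state in which the variables `10`, `11`, `12`, `13` have been set. -/
def State.args (s : State) (x y z w : ℕ) : State := (((s.set 10 x).set 11 y).set 12 z).set 13 w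

-- The formula is evaluated in the middle of the loops but its meaning refers to the initial state
-- `s`. The two agree because only loop counters, variable `2` and array `b` have changed; the
-- counters are the arguments, and the formula reads neither variable `2` nor the array being
-- overwritten.
open scoped Classical in
theorem Total.fill {b N : ℕ} {φ : Form} {s : State} (hb : b ≠ 1) (hφ : φ.Scoped b 14)
    (hs : Ready N s) :
    Total (fill b φ) s (fillTime φ N) fun s' => Agree 10 b s s' ∧
      ∀ x < N, ∀ y < N, ∀ z < N, ∀ w < N, Tab s' b x y z w ↔ φ.Sat (s.args x y z w) := by
  let F (i : ℕ) : ℕ := if ∃ x < N, ∃ y < N, ∃ z < N, ∃ w < N, i = code N x y z w ∧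
    φ.Sat (s.args x y z w) then 1 else 0
  have hF : ∀ x < N, ∀ y < N, ∀ z < N, ∀ w < N, F (code N x y z w) =
      if φ.Sat (s.args x y z w) then 1 else 0 := by
    intro x hx y hy z hz w hw
    refine if_congr ⟨?_, fun h => ⟨x, hx, y, hy, z, hz, w, hw, rfl, h⟩⟩ rfl rfl
    rintro ⟨x', _, y', hy', z', hz', w', hw', e, h⟩
    obtain ⟨rfl, rfl, rfl, rfl⟩ := code_inj hy hz hw hy' hz' hw' e
    exact h
  have main := Total.forLoop_overwrites (d := 10) (b := b) (s := s)
    (p := Prog.forBelow 11 3 (Prog.forBelow 12 3 (Prog.forBelow 13 3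
    (Prog.seq φ.comp (Prog.write b (quad 10 11 12 13) (Expr.var 2)))))) (by decide)
    (fun x => {i | ∃ y < N, i ∈ {i | ∃ z < N, i ∈ {i | ∃ w < N,
      i ∈ ({code N x y z w} : Set ℕ)}}}) F hs.1
    (fun x hx s₁ a₁ e₁ => Total.forLoop_overwrites (d := 11) (by decide) _ F
      (by rw [a₁.1 3 (by decide) (by decide), hs.1])
    fun y hy s₂ a₂ e₂ => Total.forLoop_overwrites (d := 12) (by decide) _ F
      (by rw [a₂.1 3 (by decide) (by decide), a₁.1 3 (by decide) (by decide), hs.1])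
    fun z hz s₃ a₃ e₃ => Total.forLoop_overwrites (d := 13) (T := φ.time N + 20) (by decide)
      (fun w => ({code N x y z w} : Set ℕ)) F
      (by rw [a₃.1 3 (by decide) (by decide), a₂.1 3 (by decide) (by decide),
        a₁.1 3 (by decide) (by decide), hs.1])
    fun w hw s₄ a₄ e₄ => by
      have b₄ : Agree 14 b (s.args x y z w) s₄ := by
        refine ⟨fun i hi hi2 => ?_, fun a ha => ?_⟩
        · simp only [State.args, State.set_var]
          split_ifs with h13 h12 h11 h10
          · rw [h13, e₄]
          · rw [h12, a₄.1 12 (by decide) (by decide), e₃]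
          · rw [h11, a₄.1 11 (by decide) (by decide), a₃.1 11 (by decide) (by decide), e₂]
          · rw [h10, a₄.1 10 (by decide) (by decide), a₃.1 10 (by decide) (by decide),
              a₂.1 10 (by decide) (by decide), e₁]
          · rw [a₄.1 i (by omega) hi2, a₃.1 i (by omega) hi2, a₂.1 i (by omega) hi2,
              a₁.1 i (by omega) hi2]
        · exact (a₄.2 a ha).trans ((a₃.2 a ha).trans ((a₂.2 a ha).trans (a₁.2 a ha)))
      have r₄ : Ready N s₄ := by
        refine Ready.of_agree (s := s.args x y z w) ⟨?_, hs.2⟩ (by decide) hb b₄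
        simp [State.args, State.set_var, hs.1]
      refine (Total.seq (T' := 20) ((φ.comp_total (d := 14) (by decide) hφ r₄.1).mono
        le_rfl ?_)).mono le_rfl fun _ h => h
      rintro s₅ ⟨h1, h2, h3⟩
      refine (Total.write ?_).mono (by simp [quad, Expr.cost]) fun _ h => h
      have b₅ : Agree 14 b s₄ s₅ := ⟨h2, fun a _ => by rw [h1]⟩
      have v10 : s₅.var 10 = x := by
        rw [b₅.1 10 (by decide) (by decide), b₄.1 10 (by decide) (by decide)]; rfl
      have v11 : s₅.var 11 = y := by
        rw [b₅.1 11 (by decide) (by decide), b₄.1 11 (by decide) (by decide)]; rfl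
      have v12 : s₅.var 12 = z := by
        rw [b₅.1 12 (by decide) (by decide), b₄.1 12 (by decide) (by decide)]; rfl
      have v13 : s₅.var 13 = w := by
        rw [b₅.1 13 (by decide) (by decide), b₄.1 13 (by decide) (by decide)]; rfl
      have hq : (quad 10 11 12 13).eval s₅ = code N x y z w := by
        rw [← (r₄.of_agree (by decide) hb b₅).index_eq w hx hy hz, ← v10, ← v11, ← v12, ← v13]
        rfl
      rw [hq]
      have hval : (Expr.var 2).eval s₅ = F (code N x y z w) := by
        rw [hF x hx y hy z hz w hw]
        simp only [Expr.eval, h3]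
        exact if_congr (φ.sat_congr (by decide) b₄ hφ) rfl rfl
      refine ⟨⟨h2, fun a ha => ?_⟩, ?_, ?_⟩
      · simp [Function.update_of_ne ha, h1]
      · rintro i rfl
        simpa using hval
      · intro i hi
        have hi' : i ≠ code N x y z w := hi
        simp [hi', h1])
  refine main.mono le_rfl ?_
  rintro s' ⟨h1, h2, -⟩
  refine ⟨h1, fun x hx y hy z hz w hw => ?_⟩
  rw [Tab, (hs.of_agree (by decide) hb h1).index_eq w hx hy hz, h2 _ ⟨x, hx, y, hy, z, hz, w, hw, rfl⟩, hF x hx y hy z hz w hw]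
  simp

/-- Store the multiples of the value of variable `m` in array `a`. -/
def multiples (a m : ℕ) : Prog :=
  Prog.seq (Prog.assign 20 (Expr.lit 0)) (Prog.forBelow 10 3 (Prog.forBelow 11 3 (Prog.forBelow 12 3
    (Prog.seq (Prog.write a (.add (.var 20) (.lit 1)) (.add (.read a (.var 20)) (.var m)))
      (Prog.assign 20 (.add (.var 20) (.lit 1)))))))

def multiplesTime (N : ℕ) : ℕ :=
  2 + (6 + N * (6 + N * (6 + N * (12 + 8) + 8) + 8))

/-- The nested loops serve only to run `N * N * N` rounds on a machine without multiplication. The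
current cell is tracked by variable `20`, and each entry is the preceding one plus `c`. -/
theorem Total.multiples {a m N c : ℕ} {s : State} (hN : s.var 3 = N) (hm : s.var m = c)
    (hm' : m < 10) (h0 : s.arr a 0 = 0) :
    Total (multiples a m) s (multiplesTime N) fun s' => (∀ i < 10, s'.var i = s.var i) ∧
      (∀ b, b ≠ a → s'.arr b = s.arr b) ∧ ∀ i ≤ N * N * N, s'.arr a i = i * c := by
  let Inv (v : ℕ) (s' : State) : Prop := (∀ i < 10, s'.var i = s.var i) ∧
    (∀ b, b ≠ a → s'.arr b = s.arr b) ∧ s'.var 20 = v ∧ ∀ i ≤ v, s'.arr a i = i * c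
  have insens : ∀ x, 10 ≤ x → x < 20 → ∀ v s' e, Inv v s' → Inv v (s'.set x e) := by
    rintro x hx hx' v s' e ⟨h1, h2, h3, h4⟩
    refine ⟨fun i hi => ?_, h2, ?_, h4⟩
    · rw [State.set_var_of_ne _ _ (by omega), h1 i hi]
    · rw [State.set_var_of_ne _ _ (by omega), h3]
  have bound : ∀ v s', Inv v s' → s'.var 3 = N := fun v s' h => by rw [h.1 3 (by decide), hN]
  have body : ∀ v s', Inv v s' → Total (Prog.seq
      (Prog.write a (.add (.var 20) (.lit 1)) (.add (.read a (.var 20)) (.var m)))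
      (Prog.assign 20 (.add (.var 20) (.lit 1)))) s' 12 fun s'' =>
        (∀ i ≤ 12, i ≠ 2 → s''.var i = s'.var i) ∧ Inv (v + 1) s'' := by
    rintro v s' ⟨h1, h2, h3, h4⟩
    refine (Total.seq (T' := 4) (Total.write (Total.assign ?_))).mono (by simp [Expr.cost])
      fun _ h => h
    refine ⟨fun i hi _ => State.set_var_of_ne _ _ (by omega), fun i hi => ?_, fun b hb => ?_,
      ?_, fun i hi => ?_⟩
    · rw [State.set_var_of_ne _ _ (by omega)]
      exact h1 i hi
    · simpa [Function.update_of_ne hb] using h2 b hb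
    · simp [Expr.eval, h3]
    · by_cases e : i = v + 1
      · simp [Expr.eval, e, h3, h4 v le_rfl, h1 m hm', hm, Nat.succ_mul]
      · simp [Expr.eval, h3, e, h4 i (by omega)]
  have l12 := Total.forLoop_iterate (x := 12) (m := 3) (a := 1) Inv bound
    (insens 12 (by decide) (by decide)) body (by decide)
  have l11 := Total.forLoop_iterate (x := 11) (m := 3) (a := N * 1) Inv bound
    (insens 11 (by decide) (by decide))
    (fun v s' h => (l12 v s' h).mono le_rfl fun s'' h => ⟨fun i hi => h.1 i (by omega), h.2⟩)
    (by decide)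
  have l10 := Total.forLoop_iterate (x := 10) (m := 3) (a := N * (N * 1)) Inv bound
    (insens 10 (by decide) (by decide))
    (fun v s' h => (l11 v s' h).mono le_rfl fun s'' h => ⟨fun i hi => h.1 i (by omega), h.2⟩)
    (by decide) 0 (s.set 20 0)
    ⟨fun i hi => State.set_var_of_ne _ _ (by omega), fun _ _ => rfl, by simp,
      fun i hi => by rw [Nat.le_zero.1 hi]; simpa using h0⟩
  refine (Total.seq (T := 2) (Total.assign (by simpa [Expr.eval] using l10))).mono le_rfl ?_
  rintro s' ⟨-, h1, h2, -, h4⟩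
  exact ⟨h1, h2, fun i hi => h4 i (hi.trans_eq (by ring))⟩

/-! ### Polynomial bounds -/

/-- `T` is bounded by a polynomial. -/
def PolyBounded (T : ℕ → ℕ) : Prop := ∃ b : Polynomial ℕ, ∀ n, T n ≤ b.eval n

namespace PolyBounded

theorem const (c : ℕ) : PolyBounded fun _ => c := ⟨Polynomial.C c, fun n => by simp⟩

theorem id : PolyBounded fun n => n := ⟨Polynomial.X, fun n => by simp⟩

theorem add {T T' : ℕ → ℕ} (h : PolyBounded T) (h' : PolyBounded T') :
    PolyBounded fun n => T n + T' n := by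
  obtain ⟨b, hb⟩ := h
  obtain ⟨b', hb'⟩ := h'
  exact ⟨b + b', fun n => by simpa using add_le_add (hb n) (hb' n)⟩

theorem mul {T T' : ℕ → ℕ} (h : PolyBounded T) (h' : PolyBounded T') :
    PolyBounded fun n => T n * T' n := by
  obtain ⟨b, hb⟩ := h
  obtain ⟨b', hb'⟩ := h'
  exact ⟨b * b', fun n => by simpa using Nat.mul_le_mul (hb n) (hb' n)⟩

theorem comp_succ {T : ℕ → ℕ} (h : PolyBounded T) : PolyBounded fun n => T (n + 1) := by
  obtain ⟨b, hb⟩ := h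
  exact ⟨b.comp (Polynomial.X + 1), fun n => by simpa using hb (n + 1)⟩

theorem formTime (φ : Form) : PolyBounded φ.time := by
  induction φ with
  | test e => exact const _
  | neg φ ih => exact ih.add (const 4)
  | and φ ψ ih₁ ih₂ => exact (ih₁.add ih₂).add (const 3)
  | ex x φ ih => exact (const 8).add (id.mul (ih.add (const 10)))

theorem fillTime (φ : Form) : PolyBounded (fillTime φ) := by
  have h : PolyBounded fun N => φ.time N + 20 := (formTime φ).add (const 20)
  have step : ∀ {T : ℕ → ℕ}, PolyBounded T → PolyBounded fun N => 6 + N * (T N + 8) :=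
    fun hT => (const 6).add (id.mul (hT.add (const 8)))
  exact step (step (step (step h)))

theorem multiplesTime : PolyBounded multiplesTime := by
  have step : ∀ {T : ℕ → ℕ}, PolyBounded T → PolyBounded fun N => 6 + N * (T N + 8) :=
    fun hT => (const 6).add (id.mul (hT.add (const 8)))
  exact (const 2).add (step (step (step (const 12))))

end PolyBounded

/-! ### Configurations of tokens on an interval graph -/

namespace IntervalRep

variable {V : Type*} {G : SimpleGraph V}

theorem not_adj_of_lt (R : IntervalRep G) {u v : V} (h : R.r u < R.l v) :
    ¬ G.Adj u v ∧ u ≠ v := by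
  constructor
  · rw [R.adj_iff]
    rintro ⟨-, x, hx, hx'⟩
    exact absurd (h.trans_le (hx'.1.trans hx.2)) (lt_irrefl _)
  · rintro rfl
    exact absurd (h.trans_le (R.l_le_r u)) (lt_irrefl _)

theorem l_le_r_of_adj (R : IntervalRep G) {u v : V} (h : G.Adj u v) : R.l v ≤ R.r u :=
  not_lt.1 fun h' => (R.not_adj_of_lt h').1 h

theorem adj_of_le (R : IntervalRep G) {u v : V} (huv : u ≠ v) (h : R.l u ≤ R.r v)
    (h' : R.l v ≤ R.r u) : G.Adj u v :=
  (R.adj_iff u v).2 ⟨huv, max (R.l u) (R.l v), ⟨le_max_left _ _, max_le (R.l_le_r u) h'⟩,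
    ⟨le_max_right _ _, max_le h (R.l_le_r v)⟩⟩

theorem lt_or_lt (R : IntervalRep G) {u v : V} (huv : u ≠ v) (h : ¬ G.Adj u v) :
    R.r u < R.l v ∨ R.r v < R.l u := by
  by_contra! hc
  exact h (R.adj_of_le huv hc.2 hc.1)

/-- The representation of an induced subgraph. -/
def induce (R : IntervalRep G) (S : Set V) : IntervalRep (G.induce S) where
  l v := R.l v
  r v := R.r v
  l_le_r v := R.l_le_r v
  adj_iff u v := by simp [R.adj_iff, Subtype.ext_iff]

/-- `k` tokens on pairwise disjoint segments, listed from the left to the right. -/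
abbrev Conf (R : IntervalRep G) (k : ℕ) : Type _ :=
  {f : Fin k → V // ∀ i j, i < j → R.r (f i) < R.l (f j)}

/-- The graph of configurations; a single token slides along an edge. -/
def slideGraph (R : IntervalRep G) (k : ℕ) : SimpleGraph (R.Conf k) where
  Adj f g := ∃ j, G.Adj (f.1 j) (g.1 j) ∧ ∀ i, i ≠ j → f.1 i = g.1 i
  symm := ⟨fun _ _ ⟨j, h, h'⟩ => ⟨j, h.symm, fun i hi => (h' i hi).symm⟩⟩
  loopless := ⟨fun _ ⟨_, h, _⟩ => h.ne rfl⟩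

theorem Conf.injective {R : IntervalRep G} {k : ℕ} (f : R.Conf k) : Function.Injective f.1 := by
  intro i j hij
  by_contra hne
  rcases lt_or_gt_of_ne hne with h | h
  · exact (R.not_adj_of_lt (f.2 i j h)).2 hij
  · exact (R.not_adj_of_lt (f.2 j i h)).2 hij.symm

theorem Conf.strictMono_l {R : IntervalRep G} {k : ℕ} (f : R.Conf k) :
    StrictMono fun i => R.l (f.1 i) :=
  fun i j h => (R.l_le_r _).trans_lt (f.2 i j h)

theorem Conf.mono_r {R : IntervalRep G} {k : ℕ} (f : R.Conf k) :
    Monotone fun i => R.r (f.1 i) := by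
  intro i j h
  rcases h.eq_or_lt with rfl | h
  · exact le_rfl
  · exact ((f.2 i j h).le.trans (R.l_le_r _))

/-- The independent set occupied by the tokens. -/
def Conf.indep {R : IntervalRep G} {k : ℕ} (f : R.Conf k) : IndepSets G k :=
  ⟨Finset.univ.map ⟨f.1, f.injective⟩, by
    constructor
    · intro u hu v hv huv
      simp only [Finset.coe_map, Function.Embedding.coeFn_mk, Finset.coe_univ, Set.image_univ,
        Set.mem_range] at hu hv
      obtain ⟨i, rfl⟩ := hu
      obtain ⟨j, rfl⟩ := hv
      have hij : i ≠ j := fun h => huv (h ▸ rfl)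
      rcases lt_or_gt_of_ne hij with h | h
      · exact (R.not_adj_of_lt (f.2 i j h)).1
      · exact fun ha => (R.not_adj_of_lt (f.2 j i h)).1 ha.symm
    · simp⟩

theorem Conf.mem_indep {R : IntervalRep G} {k : ℕ} (f : R.Conf k) (v : V) :
    v ∈ f.indep.1 ↔ ∃ i, f.1 i = v := by
  simp [Conf.indep]

/-- A configuration lists its vertices by increasing left end, and a strictly increasing sequence is
determined by its range. -/
theorem Conf.indep_injective (R : IntervalRep G) (k : ℕ) :
    Function.Injective (Conf.indep : R.Conf k → IndepSets G k) := by
  intro f g h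
  have hmem : ∀ v, (∃ i, f.1 i = v) ↔ ∃ i, g.1 i = v := fun v => by
    rw [← f.mem_indep, ← g.mem_indep, h]
  have hrange : Set.range (fun i => R.l (f.1 i)) = Set.range (fun i => R.l (g.1 i)) := by
    ext x
    constructor
    · rintro ⟨i, rfl⟩
      obtain ⟨j, hj⟩ := (hmem (f.1 i)).1 ⟨i, rfl⟩
      exact ⟨j, congrArg R.l hj⟩
    · rintro ⟨i, rfl⟩
      obtain ⟨j, hj⟩ := (hmem (g.1 i)).2 ⟨i, rfl⟩
      exact ⟨j, congrArg R.l hj⟩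
  have hl := StrictMono.range_inj f.strictMono_l g.strictMono_l |>.1 hrange
  refine Subtype.ext (funext fun i => ?_)
  obtain ⟨j, hj⟩ := (hmem (f.1 i)).1 ⟨i, rfl⟩
  have h1 : R.l (f.1 i) = R.l (g.1 i) := congrFun hl i
  have : j = i := g.strictMono_l.injective (by rw [hj, h1])
  rw [← hj, this]

/-- Vertices of an independent set have disjoint segments, hence distinct left ends; sorting by
these ends gives the configuration. -/
theorem Conf.indep_surjective (R : IntervalRep G) (k : ℕ) :
    Function.Surjective (Conf.indep : R.Conf k → IndepSets G k) := by
  classical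
  intro I
  have hI : ∀ u ∈ I.1, ∀ v ∈ I.1, R.l u < R.l v → R.r u < R.l v := by
    intro u hu v hv h
    have huv : u ≠ v := fun e => by simp [e] at h
    rcases R.lt_or_lt huv (I.2.isIndepSet hu hv huv) with h' | h'
    · exact h'
    · exact absurd (h.trans_le (R.l_le_r v)) (not_lt.2 h'.le)
  have hinj : Set.InjOn R.l I.1 := by
    intro u hu v hv h
    by_contra huv
    rcases R.lt_or_lt huv (I.2.isIndepSet hu hv huv) with h' | h'
    · exact absurd (h'.trans_le h.symm.le) (not_lt.2 (R.l_le_r u))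
    · exact absurd (h'.trans_le h.le) (not_lt.2 (R.l_le_r v))
  have hcard : (I.1.image R.l).card = k := by
    rw [Finset.card_image_of_injOn hinj, I.2.card_eq]
  have hex : ∀ i, ∃ v ∈ I.1, R.l v = (I.1.image R.l).orderEmbOfFin hcard i := fun i =>
    Finset.mem_image.1 (Finset.orderEmbOfFin_mem _ hcard i)
  choose f hf hl using hex
  let g : R.Conf k := ⟨f, fun i j hij => hI _ (hf i) _ (hf j) (by
    rw [hl, hl]
    exact (OrderEmbedding.lt_iff_lt _).2 hij)⟩
  refine ⟨g, Subtype.ext (Finset.eq_of_subset_of_card_le ?_ ?_)⟩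
  · intro v hv
    obtain ⟨i, rfl⟩ := (g.mem_indep v).1 hv
    exact hf i
  · rw [I.2.card_eq, g.indep.2.card_eq]

/-- Replacing a token by an adjacent vertex that fits between its neighbours. -/
theorem Conf.slide {R : IntervalRep G} {k : ℕ} (f : R.Conf k) (j : Fin k) (u : V)
    (h₁ : ∀ i < j, R.r (f.1 i) < R.l u) (h₂ : ∀ i, j < i → R.r u < R.l (f.1 i)) :
    ∃ g : R.Conf k, g.1 j = u ∧ ∀ i, i ≠ j → f.1 i = g.1 i := by
  refine ⟨⟨Function.update f.1 j u, fun a b hab => ?_⟩, by simp, fun i hi => by simp [hi]⟩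
  by_cases ha : a = j
  · subst ha
    rw [Function.update_self, Function.update_of_ne hab.ne']
    exact h₂ b hab
  · by_cases hb : b = j
    · subst hb
      rw [Function.update_self, Function.update_of_ne hab.ne]
      exact h₁ a hab
    · rw [Function.update_of_ne ha, Function.update_of_ne hb]
      exact f.2 a b hab

/-- The point is that a slide keeps the order of the tokens: if the new segment lay on the other
side of a resting token, that token would separate it from the old segment, which it meets. -/
theorem Conf.adj_indep_iff {R : IntervalRep G} {k : ℕ} (f g : R.Conf k) :
    (TS G k).Adj f.indep g.indep ↔ (R.slideGraph k).Adj f g := by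
  constructor
  · rintro ⟨u, v, hu, hv, huv⟩
    have hu' : u ∈ g.indep.1 ∧ u ∉ f.indep.1 := by
      have : u ∈ (g.indep.1 : Set V) \ (f.indep.1 : Set V) := hu ▸ rfl
      exact this
    have hv' : v ∈ f.indep.1 ∧ v ∉ g.indep.1 := by
      have : v ∈ (f.indep.1 : Set V) \ (g.indep.1 : Set V) := hv ▸ rfl
      exact this
    obtain ⟨j, rfl⟩ := (f.mem_indep v).1 hv'.1
    have hg : ∀ i, i ≠ j → f.1 i ∈ g.indep.1 := by
      intro i hi
      by_contra hc
      have : f.1 i ∈ (f.indep.1 : Set V) \ (g.indep.1 : Set V) :=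
        ⟨(f.mem_indep _).2 ⟨i, rfl⟩, hc⟩
      rw [hv] at this
      exact hi (f.injective this)
    have hlt : ∀ i, i ≠ j → R.r (f.1 i) < R.l u ∨ R.r u < R.l (f.1 i) := by
      intro i hi
      have hne : f.1 i ≠ u := fun e => hu'.2 ((f.mem_indep u).2 ⟨i, e⟩)
      exact R.lt_or_lt hne (g.indep.2.isIndepSet (hg i hi) hu'.1 hne)
    obtain ⟨h, hhj, hh⟩ := f.slide j u
      (fun i hi => (hlt i hi.ne).resolve_right fun h => by
        have := R.l_le_r_of_adj huv
        have := f.2 i j hi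
        have := R.l_le_r (f.1 i)
        linarith)
      (fun i hi => (hlt i hi.ne').resolve_left fun h => by
        have := R.l_le_r_of_adj huv.symm
        have := f.2 j i hi
        have := R.l_le_r (f.1 i)
        linarith)
    have : h = g := by
      refine Conf.indep_injective R k (Subtype.ext (Finset.eq_of_subset_of_card_le ?_ ?_))
      · intro w hw
        obtain ⟨i, rfl⟩ := (h.mem_indep w).1 hw
        by_cases hi : i = j
        · subst hi
          rw [hhj]
          exact hu'.1
        · rw [← hh i hi]
          exact hg i hi
      · rw [g.indep.2.card_eq, h.indep.2.card_eq]
    subst this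
    exact ⟨j, hhj.symm ▸ huv.symm, hh⟩
  · rintro ⟨j, hadj, h⟩
    have hf : f.1 j ∉ g.indep.1 := by
      rw [g.mem_indep]
      rintro ⟨i, hi⟩
      by_cases hij : i = j
      · subst hij
        exact hadj.ne hi.symm
      · rw [← h i hij] at hi
        exact hij (f.injective hi)
    have hg : g.1 j ∉ f.indep.1 := by
      rw [f.mem_indep]
      rintro ⟨i, hi⟩
      by_cases hij : i = j
      · subst hij
        exact hadj.ne hi
      · rw [h i hij] at hi
        exact hij (g.injective hi)
    refine ⟨g.1 j, f.1 j, Set.eq_singleton_iff_unique_mem.2 ⟨⟨(g.mem_indep _).2 ⟨j, rfl⟩, hg⟩, ?_⟩,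
      Set.eq_singleton_iff_unique_mem.2 ⟨⟨(f.mem_indep _).2 ⟨j, rfl⟩, hf⟩, ?_⟩, hadj.symm⟩
    · rintro w ⟨hw, hw'⟩
      obtain ⟨i, rfl⟩ := (g.mem_indep w).1 hw
      by_cases hij : i = j
      · rw [hij]
      · exact absurd ((f.mem_indep _).2 ⟨i, h i hij⟩) hw'
    · rintro w ⟨hw, hw'⟩
      obtain ⟨i, rfl⟩ := (f.mem_indep w).1 hw
      by_cases hij : i = j
      · rw [hij]
      · exact absurd ((g.mem_indep _).2 ⟨i, (h i hij).symm⟩) hw'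

/-- The reconfiguration graph is isomorphic to the graph of configurations. -/
noncomputable def slideIso (R : IntervalRep G) (k : ℕ) : R.slideGraph k ≃g TS G k where
  toEquiv := Equiv.ofBijective Conf.indep ⟨Conf.indep_injective R k, Conf.indep_surjective R k⟩
  map_rel_iff' := by
    intro f g
    exact f.adj_indep_iff g

theorem reachable_indep_iff {R : IntervalRep G} {k : ℕ} (f g : R.Conf k) :
    (TS G k).Reachable f.indep g.indep ↔ (R.slideGraph k).Reachable f g :=
  (R.slideIso k).reachable_iff

/-- Induction along a path. -/
theorem reachable_induction {W : Type*} {H : SimpleGraph W} {P : W → Prop} {a b : W}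
    (hab : H.Reachable a b) (ha : P a)
    (step : ∀ x y, H.Reachable a x → H.Adj x y → P x → P y) : P b := by
  rw [SimpleGraph.reachable_iff_reflTransGen] at hab
  induction hab with
  | refl => exact ha
  | tail h h' ih => exact step _ _ ((SimpleGraph.reachable_iff_reflTransGen _ _).2 h) h' ih

end IntervalRep

/-! ### Lexicographic orientation of the complement of an interval graph

Following Hell and Huang, each implication class of ordered pairs of non-adjacent vertices is
compared with its inverse by the lexicographically smallest pair. -/

section Orientation

variable {n : ℕ} (G : SimpleGraph (Fin n))

/-- `u` and `v` are distinct and not adjacent. -/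
def Apart (u v : Fin n) : Prop := u ≠ v ∧ ¬ G.Adj u v

variable {G} in
theorem Apart.symm {u v : Fin n} (h : Apart G u v) : Apart G v u :=
  ⟨h.1.symm, fun h' => h.2 h'.symm⟩

/-- The forcing relation: in a transitive orientation of the complement of `G`, one pair is
directed forward if and only if the other is. -/
def forcing : SimpleGraph (Fin n × Fin n) where
  Adj e f := Apart G e.1 e.2 ∧ Apart G f.1 f.2 ∧
    ((e.1 = f.1 ∧ G.Adj e.2 f.2) ∨ (e.2 = f.2 ∧ G.Adj e.1 f.1))
  symm := ⟨fun _ _ ⟨h, h', h''⟩ => ⟨h', h, h''.imp (fun h => ⟨h.1.symm, h.2.symm⟩)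
    fun h => ⟨h.1.symm, h.2.symm⟩⟩⟩
  loopless := ⟨fun e ⟨_, _, h⟩ => by
    rcases h with h | h
    · exact h.2.ne rfl
    · exact h.2.ne rfl⟩

/-- The lexicographic order of pairs. -/
def LexLT (e f : Fin n × Fin n) : Prop := e.1 < f.1 ∨ (e.1 = f.1 ∧ e.2 < f.2)

/-- The lexicographic orientation of the complement of `G`. -/
def LexOrient (u v : Fin n) : Prop :=
  Apart G u v ∧ ∃ e, (forcing G).Reachable (u, v) e ∧
    ∀ f, (forcing G).Reachable (v, u) f → LexLT e f

variable {G}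

theorem LexLT.irrefl (e : Fin n × Fin n) : ¬ LexLT e e := by
  rintro (h | h)
  · exact lt_irrefl _ h
  · exact lt_irrefl _ h.2

theorem LexLT.trans {e f g : Fin n × Fin n} (h : LexLT e f) (h' : LexLT f g) : LexLT e g := by
  unfold LexLT at *
  omega

theorem LexLT.total {e f : Fin n × Fin n} (h : e ≠ f) : LexLT e f ∨ LexLT f e := by
  have : e.1 ≠ f.1 ∨ e.2 ≠ f.2 := by
    by_contra! hc
    exact h (Prod.ext hc.1 hc.2)
  unfold LexLT
  omega

theorem exists_lexLT_min (P : Fin n × Fin n → Prop) {e : Fin n × Fin n} (he : P e) :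
    ∃ m, P m ∧ ∀ f, P f → m = f ∨ LexLT m f := by
  classical
  obtain ⟨m, hm, hmin⟩ := Finset.exists_min_image (Finset.univ.filter P)
    (fun e => toLex e) ⟨e, by simpa using he⟩
  refine ⟨m, by simpa using hm, fun f hf => ?_⟩
  have := (Prod.Lex.toLex_le_toLex).1 (hmin f (by simpa using hf))
  rcases this with h | ⟨h, h'⟩
  · exact Or.inr (Or.inl h)
  · rcases h'.eq_or_lt with h'' | h''
    · exact Or.inl (Prod.ext h h'')
    · exact Or.inr (Or.inr ⟨h, h''⟩)

theorem forcing_reachable_swap {u v u' v' : Fin n} (h : (forcing G).Reachable (u, v) (u', v')) :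
    (forcing G).Reachable (v, u) (v', u') := by
  let φ : forcing G →g forcing G := ⟨Prod.swap, fun {e f} ⟨h₁, h₂, h₃⟩ =>
    ⟨h₁.symm, h₂.symm, h₃.symm⟩⟩
  exact h.map φ

theorem LexOrient.congr {u v u' v' : Fin n} (h : (forcing G).Reachable (u, v) (u', v'))
    (ha : Apart G u' v') (huv : LexOrient G u v) : LexOrient G u' v' := by
  obtain ⟨-, e, he, hmin⟩ := huv
  exact ⟨ha, e, h.symm.trans he, fun f hf => hmin f ((forcing_reachable_swap h).trans hf)⟩

theorem LexOrient.of_forcing {u v u' v' : Fin n} (huv : LexOrient G u v)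
    (h : (forcing G).Adj (u, v) (u', v')) : LexOrient G u' v' :=
  huv.congr h.reachable h.2.1

theorem LexOrient.asymm {u v : Fin n} (h : LexOrient G u v) (h' : LexOrient G v u) : False := by
  obtain ⟨-, e, he, hmin⟩ := h
  obtain ⟨-, f, hf, hmin'⟩ := h'
  exact LexLT.irrefl e ((hmin f hf).trans (hmin' e he))

/-- The orientation of the complement of `G` that belongs to a representation is a union of
implication classes. -/
theorem IntervalRep.lt_of_reachable (R : IntervalRep G) {u v u' v' : Fin n}
    (h : (forcing G).Reachable (u, v) (u', v')) (huv : R.r u < R.l v) : R.r u' < R.l v' := by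
  refine IntervalRep.reachable_induction (P := fun e => R.r e.1 < R.l e.2) h huv ?_
  rintro ⟨a, b⟩ ⟨c, d⟩ - ⟨-, ⟨hcd, hcd'⟩, h⟩ hab
  refine (R.lt_or_lt hcd hcd').resolve_right fun hdc => ?_
  rcases h with ⟨h1, h2⟩ | ⟨h1, h2⟩
  · dsimp only at h1 h2 hab hdc
    have := R.l_le_r_of_adj h2.symm
    have := R.l_le_r c
    subst h1
    linarith
  · dsimp only at h1 h2 hab hdc
    have := R.l_le_r_of_adj h2
    have := R.l_le_r d
    subst h1
    linarith [R.l_le_r_of_adj h2.symm]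

/-- A representation directs all pairs of a class alike, so a class is disjoint from its inverse.
Hence the two minima are distinct and can be compared. -/
theorem LexOrient.total (R : IntervalRep G) {u v : Fin n} (h : Apart G u v) :
    LexOrient G u v ∨ LexOrient G v u := by
  obtain ⟨e, he, hmin⟩ := exists_lexLT_min (fun e => (forcing G).Reachable (u, v) e)
    (SimpleGraph.Reachable.refl _)
  obtain ⟨f, hf, hmin'⟩ := exists_lexLT_min (fun e => (forcing G).Reachable (v, u) e)
    (SimpleGraph.Reachable.refl _)
  have hne : e ≠ f := by
    rintro rfl
    have h1 := he.trans hf.symm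
    have h2 := hf.trans he.symm
    rcases R.lt_or_lt h.1 h.2 with h' | h'
    · have := R.lt_of_reachable h1 h'
      linarith [R.l_le_r u, R.l_le_r v]
    · have := R.lt_of_reachable h2 h'
      linarith [R.l_le_r u, R.l_le_r v]
  rcases LexLT.total hne with h' | h'
  · refine Or.inl ⟨h, e, he, fun g hg => ?_⟩
    rcases hmin' g hg with rfl | h''
    · exact h'
    · exact h'.trans h''
  · refine Or.inr ⟨h.symm, f, hf, fun g hg => ?_⟩
    rcases hmin g hg with rfl | h''
    · exact h'
    · exact h'.trans h''

/-- The triangle lemma: a cyclically oriented triangle `x`, `y`, `z` stays one if the pair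
`(y, z)` is replaced by another pair of its implication class. -/
theorem LexOrient.triangle {x y z y' z' : Fin n}
    (hxy : LexOrient G x y) (hyz : LexOrient G y z) (hzx : LexOrient G z x)
    (h : (forcing G).Reachable (y, z) (y', z')) :
    (forcing G).Reachable (x, y) (x, y') ∧ (forcing G).Reachable (z, x) (z', x) ∧
      LexOrient G x y' ∧ LexOrient G y' z' ∧ LexOrient G z' x := by
  refine IntervalRep.reachable_induction (P := fun e => (forcing G).Reachable (x, y) (x, e.1) ∧
    (forcing G).Reachable (z, x) (e.2, x) ∧ LexOrient G x e.1 ∧ LexOrient G e.1 e.2 ∧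
      LexOrient G e.2 x) h
    ⟨SimpleGraph.Reachable.refl _, SimpleGraph.Reachable.refl _, hxy, hyz, hzx⟩ ?_
  rintro ⟨b, c⟩ ⟨b', c'⟩ - hadj ⟨h1, h2, h3, h4, h5⟩
  dsimp only at h1 h2 h3 h4 h5 ⊢
  have h4' := h4.of_forcing hadj
  obtain ⟨-, hbc', h | h⟩ := hadj
  · obtain ⟨hb, hadj⟩ := h
    dsimp only at hb hadj hbc'
    subst hb
    -- Here `(b, c)` is replaced by `(b, c')`. If `c'` were `x` or adjacent to `x`, then `b` would
    -- be directed to `x`, against `x` to `b`. So `(c, x)` forces `(c', x)`.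
    have hap : Apart G c' x := by
      refine ⟨?_, fun hc => ?_⟩
      · rintro rfl
        exact h3.asymm h4'
      · exact h3.asymm (h4'.of_forcing ⟨hbc', h3.1.symm, Or.inl ⟨rfl, hc⟩⟩)
    have hf : (forcing G).Adj (c, x) (c', x) := ⟨h5.1, hap, Or.inr ⟨rfl, hadj⟩⟩
    exact ⟨h1, h2.trans hf.reachable, h3, h4', h5.of_forcing hf⟩
  · obtain ⟨hc, hadj⟩ := h
    dsimp only at hc hadj hbc'
    subst hc
    have hap : Apart G x b' := by
      refine ⟨?_, fun hc => ?_⟩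
      · rintro rfl
        exact h5.asymm h4'
      · exact h5.asymm (h4'.of_forcing ⟨hbc', h5.1.symm, Or.inr ⟨rfl, hc.symm⟩⟩)
    have hf : (forcing G).Adj (x, b) (x, b') := ⟨h3.1, hap, Or.inl ⟨rfl, hadj⟩⟩
    exact ⟨h1.trans hf.reachable, h2, h3.of_forcing hf, h4', h5⟩

theorem LexOrient.exists_min {u v : Fin n} (h : LexOrient G u v) :
    ∃ e, (forcing G).Reachable (u, v) e ∧
      (∀ f, (forcing G).Reachable (u, v) f → e = f ∨ LexLT e f) ∧
      ∀ f, (forcing G).Reachable (v, u) f → LexLT e f := by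
  obtain ⟨-, e, he, hlt⟩ := h
  obtain ⟨m, hm, hmin⟩ := exists_lexLT_min (fun e => (forcing G).Reachable (u, v) e) he
  refine ⟨m, hm, hmin, fun f hf => ?_⟩
  rcases hmin e he with rfl | h'
  · exact hlt f hf
  · exact h'.trans (hlt f hf)

/-- In a cyclic triangle no class can contain the smallest pair. -/
theorem LexOrient.not_cyclic_of_min {a b c : Fin n} {m₁ m₂ : Fin n × Fin n}
    (hab : LexOrient G a b) (hbc : LexOrient G b c) (hca : LexOrient G c a)
    (h₁ : (forcing G).Reachable (a, b) m₁)
    (h₁' : ∀ f, (forcing G).Reachable (b, a) f → LexLT m₁ f)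
    (h₂ : (forcing G).Reachable (b, c) m₂)
    (h : m₂ = m₁ ∨ LexLT m₂ m₁) : False := by
  obtain ⟨u, v⟩ := m₂
  obtain ⟨p, q⟩ := m₁
  obtain ⟨r1, r2, hau, huv, hva⟩ := LexOrient.triangle hab hbc hca h₂
  have hlt := h₁' _ (forcing_reachable_swap r1)
  have hpu : p = u := by
    -- The assumption gives `u ≤ p`. For the other inequality, `(u, a)` lies in the inverse of the
    -- class of `(a, b)`, whose elements all exceed `(p, q)`.
    rcases h with h | h
    · exact (congrArg Prod.fst h).symm
    · unfold LexLT at h hlt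
      dsimp only at h hlt
      omega
  subst hpu
  -- In the rotated triangle `v`, `a`, `u` the pair `(a, u)` is replaced by the minimum, whose first
  -- entry is `u`. Then `v` is directed to `u`, against `u` to `v`.
  obtain ⟨-, -, h1, -⟩ := LexOrient.triangle hva hau huv (r1.symm.trans h₁)
  exact h1.asymm huv

/-- If `a` and `c` were equal or adjacent, asymmetry or forcing would be violated; so the only
alternative is a cyclic triangle. Going round it, some class has a minimum not larger than that of
the preceding class, which `not_cyclic_of_min` excludes. -/
theorem LexOrient.trans (R : IntervalRep G) {a b c : Fin n} (hab : LexOrient G a b)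
    (hbc : LexOrient G b c) : LexOrient G a c := by
  have hac : Apart G a c := by
    refine ⟨?_, fun hc => ?_⟩
    · rintro rfl
      exact hab.asymm hbc
    · exact hbc.asymm (hab.of_forcing ⟨hab.1, hbc.1.symm, Or.inr ⟨rfl, hc⟩⟩)
  refine (LexOrient.total R hac).resolve_right fun hca => ?_
  obtain ⟨e₁, he₁, -, hs₁⟩ := hab.exists_min
  obtain ⟨e₂, he₂, -, hs₂⟩ := hbc.exists_min
  obtain ⟨e₃, he₃, -, hs₃⟩ := hca.exists_min
  have tot : ∀ e f : Fin n × Fin n, (e = f ∨ LexLT e f) ∨ (f = e ∨ LexLT f e) := fun e f => by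
    by_cases h : e = f
    · exact Or.inl (Or.inl h)
    · exact (LexLT.total h).imp Or.inr Or.inr
  rcases tot e₂ e₁ with h | h
  · exact not_cyclic_of_min hab hbc hca he₁ hs₁ he₂ h
  · rcases tot e₁ e₃ with h' | h'
    · exact not_cyclic_of_min hca hab hbc he₃ hs₃ he₁ h'
    · refine not_cyclic_of_min hbc hca hab he₂ hs₂ he₃ ?_
      rcases h' with rfl | h'
      · exact h
      · rcases h with rfl | h
        · exact Or.inr h'
        · exact Or.inr (h'.trans h)

/-- The lexicographic orientation contains no two independent pairs. -/
theorem LexOrient.two_add_two (R : IntervalRep G) {a b c d : Fin n} (hab : LexOrient G a b)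
    (hcd : LexOrient G c d) : LexOrient G a d ∨ LexOrient G c b := by
  by_contra! hc
  obtain ⟨had, hcb⟩ := hc
  have key : ∀ {a b c d : Fin n}, LexOrient G a b → LexOrient G c d → ¬ LexOrient G a d →
      ¬ LexOrient G c b → G.Adj a d := by
    intro a b c d hab hcd had hcb
    by_contra h
    by_cases e : a = d
    · subst e
      exact hcb (hcd.trans R hab)
    · rcases LexOrient.total R ⟨e, h⟩ with h' | h'
      · exact had h'
      · exact hcb ((hcd.trans R h').trans R hab)
  have h1 : G.Adj a d := key hab hcd had hcb
  have h2 : G.Adj c b := key hcd hab hcb had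
  have h3 : R.l a ≤ R.r c ∧ R.l c ≤ R.r a := by
    by_cases e : a = c
    · subst e
      exact absurd hcd had
    · by_cases h : G.Adj a c
      · exact ⟨R.l_le_r_of_adj h.symm, R.l_le_r_of_adj h⟩
      · rcases LexOrient.total R ⟨e, h⟩ with h' | h'
        · exact absurd (h'.trans R hcd) had
        · exact absurd (h'.trans R hab) hcb
  have h4 : R.l b ≤ R.r d ∧ R.l d ≤ R.r b := by
    by_cases e : b = d
    · subst e
      exact absurd hab had
    · by_cases h : G.Adj b d
      · exact ⟨R.l_le_r_of_adj h.symm, R.l_le_r_of_adj h⟩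
      · rcases LexOrient.total R ⟨e, h⟩ with h' | h'
        · exact absurd (hab.trans R h') had
        · exact absurd (hcd.trans R h') hcb
  have h5 := R.l_le_r_of_adj h1
  have h6 := R.l_le_r_of_adj h1.symm
  have h7 := R.l_le_r_of_adj h2
  have h8 := R.l_le_r_of_adj h2.symm
  rcases R.lt_or_lt hab.1.1 hab.1.2 with h | h <;>
    rcases R.lt_or_lt hcd.1.1 hcd.1.2 with h' | h' <;> linarith

/-- The lexicographic orientation is the order of the segments in some representation. -/
theorem exists_rep_lexOrient (R : IntervalRep G) :
    ∃ R' : IntervalRep G, (∀ u v, R'.r u < R'.l v ↔ LexOrient G u v) ∧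
      (∀ u v, (∀ w, LexOrient G w u → LexOrient G w v) → R'.l u ≤ R'.l v) ∧
      ∀ u v, (∀ w, LexOrient G v w → LexOrient G u w) → R'.r u ≤ R'.r v := by
  classical
  -- The standard representation of an interval order: the left end counts the predecessors, and the
  -- right end is the largest left end among the vertices that do not come later. As there are no
  -- two independent pairs, the sets of predecessors form a chain.
  let l (v : Fin n) : ℕ := (Finset.univ.filter fun w => LexOrient G w v).card
  let r (v : Fin n) : ℕ := (Finset.univ.filter fun w => ¬ LexOrient G v w).sup l
  have key : ∀ u v, r u < l v ↔ LexOrient G u v := by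
    intro u v
    constructor
    · intro h
      by_contra hc
      exact absurd h (not_lt.2 (Finset.le_sup (f := l) (by simpa using hc)))
    · intro h
      have hpos : 0 < l v := Finset.card_pos.2 ⟨u, by simpa using h⟩
      refine (Finset.sup_lt_iff hpos).2 fun w hw => Finset.card_lt_card ?_
      have hw' : ¬ LexOrient G u w := by simpa using hw
      refine Finset.ssubset_iff_of_subset (fun x hx => ?_) |>.2
        ⟨u, by simpa using h, by simpa using hw'⟩
      have hx' : LexOrient G x w := by simpa using hx
      simpa using (LexOrient.two_add_two R h hx').resolve_left hw'
  have hlr : ∀ v, l v ≤ r v := fun v =>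
    not_lt.1 fun h => ((key v v).1 h).1.1 rfl
  have key' : ∀ u v, ((r u : ℕ) : ℝ) < l v ↔ LexOrient G u v := fun u v => by
    rw [Nat.cast_lt, key]
  refine ⟨⟨fun v => l v, fun v => r v, fun v => by exact_mod_cast hlr v, fun u v => ?_⟩, key',
    fun u v h => Nat.cast_le.2 (Finset.card_le_card (Finset.monotone_filter_right _
      fun w _ => h w)),
    fun u v h => Nat.cast_le.2 (Finset.sup_mono (Finset.monotone_filter_right _
      fun w _ hw hw' => hw (h w hw')))⟩
  constructor
  · intro h
    refine ⟨h.ne, max (l u) (l v), ⟨le_max_left _ _, max_le (by exact_mod_cast hlr u) ?_⟩,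
      ⟨le_max_right _ _, max_le ?_ (by exact_mod_cast hlr v)⟩⟩
    · exact not_lt.1 fun h' => ((key' u v).1 h').1.2 h
    · exact not_lt.1 fun h' => ((key' v u).1 h').1.2 h.symm
  · rintro ⟨hne, x, hx, hx'⟩
    by_contra hc
    rcases LexOrient.total R ⟨hne, hc⟩ with h | h
    · have := (key' u v).2 h
      linarith [hx.1, hx.2, hx'.1, hx'.2]
    · have := (key' v u).2 h
      linarith [hx.1, hx.2, hx'.1, hx'.2]

end Orientation

/-! ### Barriers -/

namespace IntervalRep

variable {V : Type*} {G : SimpleGraph V}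

/-- `w` lies between the positions `X (j - 1)` and `Y (j + 1)`. -/
def Window (R : IntervalRep G) {k : ℕ} (X Y : Fin k → V) (j : Fin k) (w : V) : Prop :=
  (∀ i : Fin k, i.val + 1 = j.val → R.r (X i) < R.l w) ∧
    ∀ i : Fin k, j.val + 1 = i.val → R.r w < R.l (Y i)

/-- The token `j` cannot leave the range from `X j` to `Y j` while its neighbours stay in their
ranges. -/
structure Barrier (R : IntervalRep G) {k : ℕ} (X : R.Conf k) (Y : Fin k → V) : Prop where
  l_le : ∀ j, R.l (X.1 j) ≤ R.l (Y j)
  closed : ∀ j w u, R.Window X.1 Y j w → R.Window X.1 Y j u → G.Adj w u →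
    R.r (X.1 j) ≤ R.r w → R.l w ≤ R.l (Y j) → R.r (X.1 j) ≤ R.r u ∧ R.l u ≤ R.l (Y j)

/-- The neighbours of a moving token are in their ranges, so the positions before and after the move
both lie in the window, and `closed` applies. -/
theorem Barrier.range_of_reachable {R : IntervalRep G} {k : ℕ} {X : R.Conf k} {Y : Fin k → V}
    (h : R.Barrier X Y) {g : R.Conf k} (hg : (R.slideGraph k).Reachable X g) (j : Fin k) :
    R.r (X.1 j) ≤ R.r (g.1 j) ∧ R.l (g.1 j) ≤ R.l (Y j) := by
  revert j
  refine reachable_induction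
    (P := fun g : R.Conf k => ∀ j, R.r (X.1 j) ≤ R.r (g.1 j) ∧ R.l (g.1 j) ≤ R.l (Y j)) hg
    (fun j => ⟨le_rfl, h.l_le j⟩) ?_
  rintro f g - ⟨j, hadj, hfg⟩ hf i
  by_cases hij : i = j
  · subst hij
    have win : ∀ f' : R.Conf k, (∀ a, a ≠ i → f.1 a = f'.1 a) → R.Window X.1 Y i (f'.1 i) := by
      intro f' hf'
      constructor
      · intro a ha
        have hai : a < i := Fin.lt_def.2 (by omega)
        have := f'.2 a i hai
        rw [← hf' a hai.ne] at this
        exact (hf a).1.trans_lt this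
      · intro a ha
        have hai : i < a := Fin.lt_def.2 (by omega)
        have := f'.2 i a hai
        rw [← hf' a hai.ne'] at this
        exact this.trans_le (hf a).2
    exact h.closed i _ _ (win f fun _ _ => rfl) (win g hfg) hadj (hf i).1 (hf i).2
  · rw [← hfg i hij]
    exact hf i

/-- If `h` has the token `j` as far to the left as possible, then the tokens up to `j` can be put
at their positions in `h` while the others stay. -/
theorem exists_left_hybrid {R : IntervalRep G} {k : ℕ} {f h : R.Conf k} (j : Fin k)
    (hh : (R.slideGraph k).Reachable f h)
    (hmin : ∀ g, (R.slideGraph k).Reachable f g → R.r (h.1 j) ≤ R.r (g.1 j))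
    {g : R.Conf k} (hg : (R.slideGraph k).Reachable f g) :
    ∃ g' : R.Conf k, (R.slideGraph k).Reachable f g' ∧ (∀ i ≤ j, g'.1 i = h.1 i) ∧
      ∀ i, j < i → g'.1 i = g.1 i := by
  refine reachable_induction (P := fun g : R.Conf k => ∃ g' : R.Conf k,
    (R.slideGraph k).Reachable f g' ∧ (∀ i ≤ j, g'.1 i = h.1 i) ∧ ∀ i, j < i → g'.1 i = g.1 i)
    (hh.symm.trans hg) ⟨h, hh, fun _ _ => rfl, fun _ _ => rfl⟩ ?_
  rintro x y hx ⟨t, hadj, hxy⟩ ⟨x', hx', h1, h2⟩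
  rcases le_or_gt t j with ht | ht
  · exact ⟨x', hx', h1, fun i hi => by rw [h2 i hi, hxy i (ht.trans_lt hi).ne']⟩
  · have hy : (R.slideGraph k).Reachable f y :=
      hh.trans (hx.trans (SimpleGraph.Adj.reachable ⟨t, hadj, hxy⟩))
    -- A move of a token beyond `j` can be copied: token `j` of `h` ends no later than token `j` of
    -- `y`, so the parked tokens are not in the way.
    obtain ⟨y', hy't, hy'⟩ := x'.slide t (y.1 t)
      (fun i hi => by
        rcases le_or_gt i j with hij | hij
        · have := hmin y hy
          have := y.2 j t ht
          have := h.mono_r hij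
          rw [h1 i hij]
          dsimp only at this
          linarith
        · rw [h2 i hij, hxy i hi.ne]
          exact y.2 i t hi)
      (fun i hi => by
        rw [h2 i (ht.trans hi), hxy i hi.ne']
        exact y.2 t i hi)
    refine ⟨y', hx'.trans (SimpleGraph.Adj.reachable ⟨t, ?_, hy'⟩), fun i hi => ?_, fun i hi => ?_⟩
    · rw [hy't, h2 t ht]
      exact hadj
    · rw [← hy' i (hi.trans_lt ht).ne, h1 i hi]
    · by_cases e : i = t
      · rw [e, hy't]
      · rw [← hy' i e, h2 i hi, hxy i e]

/-- If `h` has the token `j` as far to the right as possible, then the tokens from `j` on can be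
put at their positions in `h` while the others stay. -/
theorem exists_right_hybrid {R : IntervalRep G} {k : ℕ} {f h : R.Conf k} (j : Fin k)
    (hh : (R.slideGraph k).Reachable f h)
    (hmax : ∀ g, (R.slideGraph k).Reachable f g → R.l (g.1 j) ≤ R.l (h.1 j))
    {g : R.Conf k} (hg : (R.slideGraph k).Reachable f g) :
    ∃ g' : R.Conf k, (R.slideGraph k).Reachable f g' ∧ (∀ i, j ≤ i → g'.1 i = h.1 i) ∧
      ∀ i < j, g'.1 i = g.1 i := by
  refine reachable_induction (P := fun g : R.Conf k => ∃ g' : R.Conf k,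
    (R.slideGraph k).Reachable f g' ∧ (∀ i, j ≤ i → g'.1 i = h.1 i) ∧ ∀ i < j, g'.1 i = g.1 i)
    (hh.symm.trans hg) ⟨h, hh, fun _ _ => rfl, fun _ _ => rfl⟩ ?_
  rintro x y hx ⟨t, hadj, hxy⟩ ⟨x', hx', h1, h2⟩
  rcases le_or_gt j t with ht | ht
  · exact ⟨x', hx', h1, fun i hi => by rw [h2 i hi, hxy i (hi.trans_le ht).ne]⟩
  · have hy : (R.slideGraph k).Reachable f y :=
      hh.trans (hx.trans (SimpleGraph.Adj.reachable ⟨t, hadj, hxy⟩))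
    obtain ⟨y', hy't, hy'⟩ := x'.slide t (y.1 t)
      (fun i hi => by
        rw [h2 i (hi.trans ht), hxy i hi.ne]
        exact y.2 i t hi)
      (fun i hi => by
        rcases le_or_gt j i with hij | hij
        · have := hmax y hy
          have := y.2 t j ht
          have := h.strictMono_l.monotone hij
          rw [h1 i hij]
          linarith
        · rw [h2 i hij, hxy i hi.ne']
          exact y.2 t i hi)
    refine ⟨y', hx'.trans (SimpleGraph.Adj.reachable ⟨t, ?_, hy'⟩), fun i hi => ?_, fun i hi => ?_⟩
    · rw [hy't, h2 t ht]
      exact hadj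
    · rw [← hy' i (ht.trans_le hi).ne', h1 i hi]
    · by_cases e : i = t
      · rw [e, hy't]
      · rw [← hy' i e, h2 i hi, hxy i e]

/-- The extreme positions of the tokens in a component form a barrier. -/
theorem exists_barrier [Finite V] (R : IntervalRep G) {k : ℕ} (f : R.Conf k) :
    ∃ (X : R.Conf k) (Y : Fin k → V), R.Barrier X Y ∧ (R.slideGraph k).Reachable f X ∧
      ∀ g, (R.slideGraph k).Reachable f g → ∀ j, R.r (X.1 j) ≤ R.r (g.1 j) := by
  have hmin : ∀ j : Fin k, ∃ h, (R.slideGraph k).Reachable f h ∧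
      ∀ g, (R.slideGraph k).Reachable f g → R.r (h.1 j) ≤ R.r (g.1 j) := fun j => by
    obtain ⟨h, hh, hm⟩ := Set.exists_min_image {g | (R.slideGraph k).Reachable f g}
      (fun g => R.r (g.1 j)) (Set.toFinite _) ⟨f, SimpleGraph.Reachable.refl _⟩
    exact ⟨h, hh, hm⟩
  have hmax : ∀ j : Fin k, ∃ h, (R.slideGraph k).Reachable f h ∧
      ∀ g, (R.slideGraph k).Reachable f g → R.l (g.1 j) ≤ R.l (h.1 j) := fun j => by
    obtain ⟨h, hh, hm⟩ := Set.exists_max_image {g | (R.slideGraph k).Reachable f g}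
      (fun g => R.l (g.1 j)) (Set.toFinite _) ⟨f, SimpleGraph.Reachable.refl _⟩
    exact ⟨h, hh, hm⟩
  choose mn hmn hmn' using hmin
  choose mx hmx hmx' using hmax
  -- Compared with the configuration that is extremal for `j`, token `i` is only moved to the left,
  -- so the order persists.
  let X : R.Conf k := ⟨fun j => (mn j).1 j, fun i j hij =>
    (hmn' i _ (hmn j)).trans_lt ((mn j).2 i j hij)⟩
  let Y : Fin k → V := fun j => (mx j).1 j
  -- a vertex of the window next to a reachable position is reachable
  have move : ∀ (j : Fin k) (g : R.Conf k) (w : V), (R.slideGraph k).Reachable f g →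
      R.Window X.1 Y j w → G.Adj (g.1 j) w →
      ∃ g', (R.slideGraph k).Reachable f g' ∧ g'.1 j = w := by
    intro j g w hg hw hadj
    -- Token `j - 1` is parked at its leftmost and then token `j + 1` at its rightmost position,
    -- while token `j` stays. Afterwards the whole window is free for token `j`.
    obtain ⟨g₁, hg₁, h₁, h₁'⟩ : ∃ g₁ : R.Conf k, (R.slideGraph k).Reachable f g₁ ∧
        (∀ i : Fin k, i.val + 1 = j.val → g₁.1 i = X.1 i) ∧ g₁.1 j = g.1 j := by
      by_cases h0 : ∃ i : Fin k, i.val + 1 = j.val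
      · obtain ⟨i, hi⟩ := h0
        obtain ⟨g', a1, a2, a3⟩ := exists_left_hybrid i (hmn i) (hmn' i) hg
        refine ⟨g', a1, fun i' hi' => ?_, a3 j (Fin.lt_def.2 (by omega))⟩
        obtain rfl : i' = i := Fin.ext (by omega)
        exact a2 i' le_rfl
      · exact ⟨g, hg, fun i hi => absurd ⟨i, hi⟩ h0, rfl⟩
    obtain ⟨g₂, hg₂, h₂, h₂', h₂''⟩ : ∃ g₂ : R.Conf k, (R.slideGraph k).Reachable f g₂ ∧
        (∀ i : Fin k, i.val + 1 = j.val → g₂.1 i = X.1 i) ∧ g₂.1 j = g.1 j ∧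
        ∀ i : Fin k, j.val + 1 = i.val → g₂.1 i = Y i := by
      by_cases h0 : ∃ i : Fin k, j.val + 1 = i.val
      · obtain ⟨i, hi⟩ := h0
        obtain ⟨g', a1, a2, a3⟩ := exists_right_hybrid i (hmx i) (hmx' i) hg₁
        refine ⟨g', a1, fun i' hi' => ?_, ?_, fun i' hi' => ?_⟩
        · rw [a3 i' (Fin.lt_def.2 (by omega)), h₁ i' hi']
        · rw [a3 j (Fin.lt_def.2 (by omega)), h₁']
        · obtain rfl : i' = i := Fin.ext (by omega)
          exact a2 i' le_rfl
      · exact ⟨g₁, hg₁, h₁, h₁', fun i hi => absurd ⟨i, hi⟩ h0⟩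
    obtain ⟨g', e, hg'⟩ := g₂.slide j w
      (fun i hi => by
        let a : Fin k := ⟨j.val - 1, by omega⟩
        have hi' := Fin.lt_def.1 hi
        have ha : a.val + 1 = j.val := by simp only [a]; omega
        have h3 := hw.1 a ha
        rw [← h₂ a ha] at h3
        exact (g₂.mono_r (Fin.le_def.2 (by omega) : i ≤ a)).trans_lt h3)
      (fun i hi => by
        have hi' := Fin.lt_def.1 hi
        let a : Fin k := ⟨j.val + 1, by omega⟩
        have ha : j.val + 1 = a.val := rfl
        have h3 := hw.2 a ha
        rw [← h₂'' a ha] at h3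
        exact h3.trans_le (g₂.strictMono_l.monotone (Fin.le_def.2 (by omega) : a ≤ i)))
    refine ⟨g', hg₂.trans (SimpleGraph.Adj.reachable ⟨j, ?_, hg'⟩), e⟩
    rw [e, h₂']
    exact hadj
  -- The extremes are attained simultaneously: a configuration that agrees with `X` before `m` is
  -- combined with the one that is extremal for token `m`.
  have hX : ∀ m ≤ k, ∃ g : R.Conf k, (R.slideGraph k).Reachable f g ∧
      ∀ j : Fin k, j.val < m → g.1 j = X.1 j := by
    intro m
    induction m with
    | zero => exact fun _ => ⟨f, SimpleGraph.Reachable.refl _, fun j hj => by omega⟩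
    | succ m ih =>
      intro hm
      obtain ⟨g, hg, hgX⟩ := ih (by omega)
      by_cases h0 : m = 0
      · subst h0
        refine ⟨mn ⟨0, hm⟩, hmn _, fun j hj => ?_⟩
        obtain rfl : j = ⟨0, hm⟩ := Fin.ext (by simp only; omega)
        rfl
      · have hgj : g.1 ⟨m - 1, by omega⟩ = X.1 ⟨m - 1, by omega⟩ :=
          hgX _ (by simp only; omega)
        obtain ⟨g', a1, a2, a3⟩ := exists_left_hybrid ⟨m - 1, by omega⟩ hg
          (by rw [hgj]; exact hmn' _) (hmn ⟨m, hm⟩)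
        refine ⟨g', a1, fun j hj => ?_⟩
        by_cases e : j.val = m
        · rw [a3 j (Fin.lt_def.2 (by simp only; omega))]
          obtain rfl : j = ⟨m, hm⟩ := Fin.ext e
          rfl
        · rw [a2 j (Fin.le_def.2 (by simp only; omega)), hgX j (by omega)]
  obtain ⟨g, hg, hgX⟩ := hX k le_rfl
  have hgX' : g = X := Subtype.ext (funext fun j => hgX j j.2)
  refine ⟨X, Y, ⟨fun j => hmx' j (mn j) (hmn j), ?_⟩, hgX' ▸ hg, fun g hg j => hmn' j g hg⟩
  intro j w u hw hu hadj hrw hlw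
  -- the position `w` is reachable: otherwise the token could not pass it
  have hw' : ∃ g, (R.slideGraph k).Reachable f g ∧ g.1 j = w := by
    by_contra hcon
    have hside : ∀ g, (R.slideGraph k).Reachable f g →
        R.r (g.1 j) < R.l w ∨ R.r w < R.l (g.1 j) := fun g hg =>
      R.lt_or_lt (fun e => hcon ⟨g, hg, e⟩) fun ha => hcon (move j g w hg hw ha)
    have hall : R.r ((mx j).1 j) < R.l w := by
      refine reachable_induction (P := fun g : R.Conf k => R.r (g.1 j) < R.l w)
        ((hmn j).symm.trans (hmx j)) ?_ ?_
      · refine (hside _ (hmn j)).resolve_right fun h => ?_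
        exact absurd (h.trans_le (R.l_le_r _)) (not_lt.2 hrw)
      · rintro x y hx ⟨t, hadj', hxy⟩ hlt
        by_cases e : j = t
        · subst e
          have hy := (hmn j).trans (hx.trans (SimpleGraph.Adj.reachable ⟨j, hadj', hxy⟩))
          refine (hside y hy).resolve_right fun h => ?_
          have := R.l_le_r_of_adj hadj'
          have := R.l_le_r w
          linarith
        · rw [← hxy j e]
          exact hlt
    have := R.l_le_r ((mx j).1 j)
    have : R.l w ≤ R.l ((mx j).1 j) := hlw
    linarith
  obtain ⟨g₁, hg₁, rfl⟩ := hw'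
  obtain ⟨g₂, hg₂, rfl⟩ := move j g₁ u hg₁ hu hadj
  exact ⟨hmn' j _ hg₂, hmx' j _ hg₂⟩

/-- Two configurations whose tokens have pairwise the same right end points. -/
theorem reachable_of_r_eq {R : IntervalRep G} {k : ℕ} {f g : R.Conf k}
    (h : ∀ j, R.r (f.1 j) = R.r (g.1 j)) : (R.slideGraph k).Reachable f g := by
  have key : ∀ m ≤ k, ∃ x : R.Conf k, (R.slideGraph k).Reachable f x ∧
      ∀ j : Fin k, (j.val < m → x.1 j = g.1 j) ∧ (m ≤ j.val → x.1 j = f.1 j) := by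
    intro m
    induction m with
    | zero => exact fun _ => ⟨f, SimpleGraph.Reachable.refl _, fun j => ⟨fun h => by omega,
        fun _ => rfl⟩⟩
    | succ m ih =>
      intro hm
      obtain ⟨x, hx, hx'⟩ := ih (by omega)
      have hxr : ∀ j, R.r (x.1 j) = R.r (g.1 j) := fun j => by
        rcases lt_or_ge j.val m with hj | hj
        · rw [(hx' j).1 hj]
        · rw [(hx' j).2 hj, h]
      -- Tokens are exchanged one by one. The right ends do not change, so the order persists, and
      -- two segments with the same right end meet.
      obtain ⟨y, hy, hxy⟩ := x.slide ⟨m, hm⟩ (g.1 ⟨m, hm⟩)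
        (fun i hi => by
          rw [hxr]
          exact g.2 _ _ hi)
        (fun i hi => by
          rw [← hxr]
          exact x.2 _ _ hi)
      have hxy' : (R.slideGraph k).Reachable x y := by
        by_cases e : x.1 ⟨m, hm⟩ = y.1 ⟨m, hm⟩
        · have : x = y := Subtype.ext (funext fun i => by
            by_cases hi : i = ⟨m, hm⟩
            · rw [hi, e]
            · exact hxy i hi)
          rw [this]
        · refine SimpleGraph.Adj.reachable ⟨⟨m, hm⟩, R.adj_of_le e ?_ ?_, hxy⟩
          · rw [hy, ← hxr]
            exact R.l_le_r _
          · rw [hxr, hy]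
            exact R.l_le_r _
      refine ⟨y, hx.trans hxy', fun j => ⟨fun hj => ?_, fun hj => ?_⟩⟩
      · by_cases e : j = ⟨m, hm⟩
        · rw [e, hy]
        · rw [← hxy j e]
          exact (hx' j).1 (lt_of_le_of_ne (by omega) fun e' => e (Fin.ext e'))
      · rw [← hxy j (fun e => by simp [e] at hj)]
        exact (hx' j).2 (by omega)
  obtain ⟨x, hx, hx'⟩ := key k le_rfl
  have : x = g := Subtype.ext (funext fun j => (hx' j).1 j.2)
  exact this ▸ hx

/-- Applied to the leftmost configurations of two components in both directions, the absence of such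
a `g` forces equal right ends, and then `reachable_of_r_eq` joins the components. -/
theorem not_preconnected_iff [Finite V] (R : IntervalRep G) (k : ℕ) :
    ¬ (R.slideGraph k).Preconnected ↔ ∃ (X : R.Conf k) (Y : Fin k → V) (g : R.Conf k)
      (j : Fin k), R.Barrier X Y ∧ R.r (g.1 j) < R.r (X.1 j) := by
  constructor
  · intro h
    by_contra! hc
    refine h fun f g => ?_
    obtain ⟨X, Y, hXY, hX, -⟩ := R.exists_barrier f
    obtain ⟨X', Y', hXY', hX', -⟩ := R.exists_barrier g
    exact (hX.trans (reachable_of_r_eq fun j => le_antisymm (hc X Y X' j hXY)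
      (hc X' Y' X j hXY'))).trans hX'.symm
  · rintro ⟨X, Y, g, j, hXY, hj⟩ h
    exact absurd hj (not_lt.2 (hXY.range_of_reachable (h X g) j).1)

end IntervalRep

/-! ### The criterion in terms of the worst l-indices -/

namespace IntervalRep

variable {V : Type*} {G : SimpleGraph V}

theorem Conf.isLeftmostVertex_iff {R : IntervalRep G} {k : ℕ} (f : R.Conf (k + 1)) (x : V) :
    IsLeftmostVertex R.r f.indep.1 x ↔ x = f.1 0 := by
  constructor
  · rintro ⟨hx, hmin⟩
    obtain ⟨i, rfl⟩ := (f.mem_indep x).1 hx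
    by_contra h
    have hi : 0 < i := Fin.pos_iff_ne_zero.2 fun e => h (e ▸ rfl)
    have := hmin _ ((f.mem_indep _).2 ⟨0, rfl⟩)
    linarith [f.2 0 i hi, R.l_le_r (f.1 i)]
  · rintro rfl
    refine ⟨(f.mem_indep _).2 ⟨0, rfl⟩, fun v hv => ?_⟩
    obtain ⟨i, rfl⟩ := (f.mem_indep v).1 hv
    exact f.mono_r (Fin.zero_le i)

theorem Conf.isLM_iff {R : IntervalRep G} {k : ℕ} (f : R.Conf (k + 1)) (x : V) :
    IsLM G R.r f.indep x ↔ (∃ g, (R.slideGraph (k + 1)).Reachable f g ∧ x = g.1 0) ∧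
      ∀ g, (R.slideGraph (k + 1)).Reachable f g → R.r x ≤ R.r (g.1 0) := by
  refine and_congr ⟨?_, ?_⟩ ⟨?_, ?_⟩
  · rintro ⟨J, hJ, hx⟩
    obtain ⟨g, rfl⟩ := Conf.indep_surjective R _ J
    exact ⟨g, (reachable_indep_iff f g).1 hJ, (g.isLeftmostVertex_iff x).1 hx⟩
  · rintro ⟨g, hg, hx⟩
    exact ⟨g.indep, (reachable_indep_iff f g).2 hg, (g.isLeftmostVertex_iff x).2 hx⟩
  · intro h g hg
    exact h g.indep _ ((reachable_indep_iff f g).2 hg) ((g.isLeftmostVertex_iff _).2 rfl)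
  · intro h J y hJ hy
    obtain ⟨g, rfl⟩ := Conf.indep_surjective R _ J
    rw [(g.isLeftmostVertex_iff y).1 hy]
    exact h g ((reachable_indep_iff f g).1 hJ)

theorem Conf.exists_isLM [Finite V] {R : IntervalRep G} {k : ℕ} (f : R.Conf (k + 1)) :
    ∃ x, IsLM G R.r f.indep x := by
  obtain ⟨h, hh, hm⟩ := Set.exists_min_image {g | (R.slideGraph (k + 1)).Reachable f g}
    (fun g => R.r (g.1 0)) (Set.toFinite _) ⟨f, SimpleGraph.Reachable.refl _⟩
  exact ⟨h.1 0, (f.isLM_iff _).2 ⟨⟨h, hh, rfl⟩, hm⟩⟩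

theorem Conf.exists_isWorstL [Finite V] {R : IntervalRep G} {k : ℕ} (f : R.Conf (k + 1)) :
    ∃ x, IsWorstL G R.r (k + 1) (f.1 0) x := by
  obtain ⟨y, hy⟩ := f.exists_isLM
  obtain ⟨x, ⟨I, hI, hx⟩, hmax⟩ := Set.exists_max_image
    {x | ∃ I : IndepSets G (k + 1), IsLeftmostVertex R.r I.1 (f.1 0) ∧ IsLM G R.r I x} R.r
    (Set.toFinite _) ⟨y, f.indep, (f.isLeftmostVertex_iff _).2 rfl, hy⟩
  exact ⟨x, ⟨I, hI, hx⟩, fun J z hJ hz => hmax z ⟨J, hJ, hz⟩⟩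

/-- The restriction to the whole vertex set changes nothing. -/
def slideUnivIso (R : IntervalRep G) (k : ℕ) :
    (R.induce Set.univ).slideGraph k ≃g R.slideGraph k where
  toFun f := ⟨fun i => (f.1 i).1, f.2⟩
  invFun f := ⟨fun i => ⟨f.1 i, trivial⟩, f.2⟩
  left_inv _ := rfl
  right_inv _ := rfl
  map_rel_iff' := by
    intro f g
    simp [slideGraph, Subtype.ext_iff]

/-! ### Adding and removing the leftmost token -/

section Cons

variable {R : IntervalRep G} {S S' : Set V} {x : V} (hx : x ∈ S)
  (hS : ∀ v, v ∈ S' ↔ v ∈ S ∧ R.r x < R.l v)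

/-- Put a further token on `x`, to the left of all others. -/
def Conf.cons {m : ℕ} (f : (R.induce S').Conf m) : (R.induce S).Conf (m + 1) :=
  ⟨Fin.cons ⟨x, hx⟩ fun i => ⟨(f.1 i).1, ((hS _).1 (f.1 i).2).1⟩, by
    intro i j hij
    induction j using Fin.cases with
    | zero => exact absurd hij (Fin.not_lt_zero i)
    | succ j =>
      induction i using Fin.cases with
      | zero => exact ((hS _).1 (f.1 j).2).2
      | succ i => exact f.2 i j (Fin.succ_lt_succ_iff.1 hij)⟩

theorem Conf.reachable_cons {m : ℕ} {f g : (R.induce S').Conf m}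
    (h : ((R.induce S').slideGraph m).Reachable f g) :
    ((R.induce S).slideGraph (m + 1)).Reachable (Conf.cons hx hS f) (Conf.cons hx hS g) := by
  refine reachable_induction (P := fun g => ((R.induce S).slideGraph (m + 1)).Reachable
    (Conf.cons hx hS f) (Conf.cons hx hS g)) h (SimpleGraph.Reachable.refl _) ?_
  rintro a b - ⟨j, hadj, hab⟩ ih
  refine ih.trans (SimpleGraph.Adj.reachable ⟨j.succ, hadj, fun i hi => ?_⟩)
  induction i using Fin.cases with
  | zero => rfl
  | succ i =>
    have := hab i fun e => hi (e ▸ rfl)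
    exact Subtype.ext (Subtype.ext_iff.1 this :)

variable (hmin : ∀ v ∈ S, R.r x ≤ R.r v)

/-- Remove the leftmost token. -/
def Conf.tail {m : ℕ} (f : (R.induce S).Conf (m + 1)) : (R.induce S').Conf m :=
  ⟨fun i => ⟨(f.1 i.succ).1, (hS _).2
    ⟨(f.1 i.succ).2, (hmin _ (f.1 0).2).trans_lt (f.2 0 i.succ (Fin.succ_pos i))⟩⟩,
    fun i j hij => f.2 i.succ j.succ (Fin.succ_lt_succ_iff.2 hij)⟩

/-- Moves of the first token become trivial, and all other moves survive. -/
theorem Conf.reachable_tail {m : ℕ} {f g : (R.induce S).Conf (m + 1)}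
    (h : ((R.induce S).slideGraph (m + 1)).Reachable f g) :
    ((R.induce S').slideGraph m).Reachable (Conf.tail hS hmin f) (Conf.tail hS hmin g) := by
  refine reachable_induction (P := fun g => ((R.induce S').slideGraph m).Reachable
    (Conf.tail hS hmin f) (Conf.tail hS hmin g)) h (SimpleGraph.Reachable.refl _) ?_
  rintro a b - ⟨j, hadj, hab⟩ ih
  refine ih.trans ?_
  induction j using Fin.cases with
  | zero =>
    have : Conf.tail hS hmin a = Conf.tail hS hmin b :=
      Subtype.ext (funext fun i => Subtype.ext
        (Subtype.ext_iff.1 (hab i.succ (Fin.succ_ne_zero i)) :))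
    rw [this]
  | succ j =>
    refine SimpleGraph.Adj.reachable ⟨j, hadj, fun i hi => Subtype.ext ?_⟩
    exact (Subtype.ext_iff.1 (hab i.succ fun e => hi (Fin.succ_injective _ e)) :)

end Cons

end IntervalRep

/-- The vertex sets that belong to the leftmost independent set of an upward closed set. -/
theorem LeftmostList.exists_sets {V : Type*} {l r : V → ℝ} (hlr : ∀ v, l v ≤ r v) {S : Set V}
    {L : List V} (h : LeftmostList l r S L) (hS : ∀ u ∈ S, ∀ v, r u < l v → v ∈ S) :
    ∃ T : ℕ → Set V, T 0 = S ∧ (∀ i, T (i + 1) = rightOf l r L (i + 1)) ∧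
      (∀ i (hi : i < L.length), L[i] ∈ T i ∧ (∀ v ∈ T i, r L[i] ≤ r v) ∧
        T (i + 1) = {v ∈ T i | r L[i] < l v}) ∧ T L.length = ∅ := by
  induction h with
  | nil =>
    -- Past the end of the list `rightOf` is the whole type, so nothing is claimed there; emptiness
    -- holds at the index `L.length` itself.
    refine ⟨fun i => match i with
      | 0 => ∅
      | i + 1 => rightOf l r [] (i + 1), rfl, fun _ => rfl, fun i hi => ?_, rfl⟩
    exact absurd hi (Nat.not_lt_zero i)
  | cons S u L hu hmin hL ih =>
    obtain ⟨T, h0, h1, h2, h3⟩ := ih fun x hx v hv =>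
      ⟨hS x hx.1 v hv, hx.2.trans_le ((hlr x).trans hv.le)⟩
    refine ⟨fun i => match i with
      | 0 => S
      | i + 1 => T i, rfl, fun i => ?_, fun i hi => ?_, h3⟩
    · cases i with
      | zero =>
        change T 0 = _
        rw [h0]
        ext v
        simp only [Set.mem_ofPred_eq, rightOf, List.getElem?_cons_zero, Option.some.injEq,
          forall_eq']
        exact ⟨fun h => h.2, fun h => ⟨hS u hu v h, h⟩⟩
      | succ i =>
        change T (i + 1) = _
        rw [h1]
        simp [rightOf]
    · cases i with
      | zero => exact ⟨hu, hmin, h0⟩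
      | succ i => exact h2 i (by simpa using hi)

theorem LeftmostList.rightOf_spec {V : Type*} {l r : V → ℝ} (hlr : ∀ v, l v ≤ r v)
    {L : List V} (h : LeftmostList l r Set.univ L) :
    (∀ i (hi : i < L.length), L[i] ∈ rightOf l r L i ∧ (∀ v ∈ rightOf l r L i, r L[i] ≤ r v) ∧
        rightOf l r L (i + 1) = {v ∈ rightOf l r L i | r L[i] < l v}) ∧
      rightOf l r L L.length = ∅ := by
  obtain ⟨T, h0, h1, h2, h3⟩ := h.exists_sets hlr fun _ _ _ _ => trivial
  have hT : T = rightOf l r L := by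
    funext i
    cases i with
    | zero => exact h0
    | succ i => exact h1 i
  subst hT
  exact ⟨h2, h3⟩

namespace IntervalRep

variable {V : Type*} {G : SimpleGraph V}

/-- By hypothesis the worst case of the leftmost reachable vertex is already the vertex `L[i]` with
the smallest right end, so every component contains a configuration that starts with it. Its other
tokens lie in the next vertex set, where one token fewer remains and the induction hypothesis
applies. -/
theorem preconnected_induce_of_isWorstL [Finite V] (R : IntervalRep G) (hR : R.Distinct) {k : ℕ}
    {L : List V} (hL : LeftmostList R.l R.r Set.univ L)
    (H : ∀ i ≤ k, i ≤ L.length → ∀ a x : rightOf R.l R.r L i,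
      IsWorstL (G.induce (rightOf R.l R.r L i)) (fun v => R.r v) (k - i) a x →
        L[i]? = some x.val) (m : ℕ) :
    ∀ i, i + m = k → i ≤ L.length →
      ((R.induce (rightOf R.l R.r L i)).slideGraph m).Preconnected := by
  have hinj : Function.Injective R.r := hR.comp Sum.inr_injective
  obtain ⟨hstep, hlast⟩ := hL.rightOf_spec R.l_le_r
  induction m with
  | zero =>
    intro i _ _ f g
    rw [Subsingleton.elim f g]
  | succ m ih =>
    intro i hi hiL
    rcases hiL.eq_or_lt with e | hlt
    · subst e
      intro f
      exact (Set.eq_empty_iff_forall_notMem.1 hlast _ (f.1 0).2).elim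
    · obtain ⟨hmem, hmin, hnext'⟩ := hstep i hlt
      have hnext := Set.ext_iff.1 hnext'
      have IH := ih (i + 1) (by omega) hlt
      have key : ∀ f : (R.induce (rightOf R.l R.r L i)).Conf (m + 1), ∃ g,
          ((R.induce (rightOf R.l R.r L i)).slideGraph (m + 1)).Reachable f
            (Conf.cons hmem hnext g) := by
        intro f
        obtain ⟨x, hx⟩ := f.exists_isWorstL
        obtain ⟨y, hy⟩ := f.exists_isLM
        have hxL := H i (by omega) hiL (f.1 0) x (by
          have : k - i = m + 1 := by omega
          rw [this]
          exact hx)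
        have hyx := hx.2 f.indep y ((f.isLeftmostVertex_iff _).2 rfl) hy
        rw [List.getElem?_eq_getElem hlt, Option.some.injEq] at hxL
        have hyL : y.1 = L[i] := hinj (le_antisymm (hxL ▸ hyx) (hmin _ y.2))
        obtain ⟨⟨g, hg, hgy⟩, -⟩ := (f.isLM_iff y).1 hy
        refine ⟨Conf.tail hnext hmin g, ?_⟩
        have : Conf.cons hmem hnext (Conf.tail hnext hmin g) = g := by
          refine Subtype.ext (funext fun j => ?_)
          induction j using Fin.cases with
          | zero => exact Subtype.ext (by rw [← hgy]; exact hyL.symm)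
          | succ j => rfl
        rw [this]
        exact hg
      intro f g
      obtain ⟨f', hf'⟩ := key f
      obtain ⟨g', hg'⟩ := key g
      exact (hf'.trans (Conf.reachable_cons hmem hnext (IH f' g'))).trans hg'.symm

/-- Put `L[i]` in front of two configurations of the next vertex set, join the results, and delete
the first token along the walk. -/
theorem preconnected_induce [Finite V] (R : IntervalRep G) {k : ℕ}
    {L : List V} (hL : LeftmostList R.l R.r Set.univ L)
    (H : (R.slideGraph k).Preconnected) (i : ℕ) :
    ∀ m, i + m = k → i ≤ L.length →
      ((R.induce (rightOf R.l R.r L i)).slideGraph m).Preconnected := by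
  obtain ⟨hstep, -⟩ := hL.rightOf_spec R.l_le_r
  induction i with
  | zero =>
    intro m hm _
    obtain rfl : m = k := by omega
    exact (R.slideUnivIso m).preconnected_iff.2 H
  | succ i ih =>
    intro m hm hiL f g
    obtain ⟨hmem, hmin, hnext'⟩ := hstep i hiL
    have hnext := Set.ext_iff.1 hnext'
    exact Conf.reachable_tail hnext hmin
      (ih (m + 1) (by omega) (by omega) (Conf.cons hmem hnext f) (Conf.cons hmem hnext g))

theorem preconnected_iff_isWorstL [Finite V] (R : IntervalRep G) (hR : R.Distinct) (k : ℕ)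
    {L : List V} (hL : LeftmostList R.l R.r Set.univ L) :
    (TS G k).Preconnected ↔
      ∀ i ≤ k, i ≤ L.length → ∀ a x : rightOf R.l R.r L i,
        IsWorstL (G.induce (rightOf R.l R.r L i)) (fun v => R.r v) (k - i) a x →
          L[i]? = some x.val := by
  have hinj : Function.Injective R.r := hR.comp Sum.inr_injective
  obtain ⟨hstep, hlast⟩ := hL.rightOf_spec R.l_le_r
  rw [← (R.slideIso k).preconnected_iff]
  constructor
  · intro H i hik hiL a x
    have hpre := R.preconnected_induce hL H i (k - i) (by omega) hiL
    generalize k - i = m at hpre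
    rintro ⟨⟨I, ha, hx⟩, -⟩
    have hlt : i < L.length := by
      refine lt_of_le_of_ne hiL fun e => ?_
      rw [← e] at hlast
      exact Set.eq_empty_iff_forall_notMem.1 hlast _ x.2
    rw [List.getElem?_eq_getElem hlt, Option.some.injEq]
    obtain ⟨hmem, hmin, -⟩ := hstep i hlt
    obtain ⟨f, rfl⟩ := Conf.indep_surjective (R.induce (rightOf R.l R.r L i)) m I
    cases m with
    -- Without tokens there is no leftmost vertex, so the worst l-index is undefined.
    | zero =>
      obtain ⟨j, -⟩ := (f.mem_indep a).1 ha.1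
      exact j.elim0
    | succ m =>
      -- As `L[i]` ends first, it may replace the first token of any configuration; connectedness
      -- puts the result into the component of `f`.
      obtain ⟨g, hg, -⟩ := f.slide 0 ⟨L[i], hmem⟩ (fun j hj => absurd hj (Fin.not_lt_zero j))
        fun j hj => (hmin _ (f.1 0).2).trans_lt (f.2 0 j hj)
      have hle := ((f.isLM_iff x).1 hx).2 g (hpre f g)
      rw [hg] at hle
      exact hinj (le_antisymm (hmin _ x.2) hle)
  · intro H
    exact (R.slideUnivIso k).preconnected_iff.1
      (R.preconnected_induce_of_isWorstL hR hL H k 0 (by omega) (Nat.zero_le _))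

end IntervalRep

/-! ### Barriers as sequences of quadruples of numbers -/

/-- A quadruple of numbers. -/
@[ext] structure Quad where
  x : ℕ
  y : ℕ
  g : ℕ
  f : ℕ

namespace IntervalRep

variable {n : ℕ} {G : SimpleGraph (Fin n)}

/-- The number `n` stands for a boundary. The quadruple before token `j` consists of the left end
of the range of token `j - 1`, the right end of the range of token `j`, the position of token
`j - 1` in a second configuration, and a flag that tells whether one of its tokens so far lies to
the left of the range of the token with the same number. -/
def Advance (R : IntervalRep G) (p q : Quad) : Prop :=
  ∃ X Y A : Fin n, q.x = X ∧ p.y = Y ∧ q.g = A ∧ (∀ v : Fin n, p.x = v → R.r v < R.l X) ∧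
    (∀ v : Fin n, p.g = v → R.r v < R.l A) ∧ R.l X ≤ R.l Y ∧
    (q.f ≠ 0 → p.f ≠ 0 ∨ R.r A < R.r X) ∧
    ∀ w u : Fin n, (∀ v : Fin n, p.x = v → R.r v < R.l w) → (∀ v : Fin n, p.x = v → R.r v < R.l u) →
      (∀ v : Fin n, q.y = v → R.r w < R.l v) → (∀ v : Fin n, q.y = v → R.r u < R.l v) →
      G.Adj w u → R.r X ≤ R.r w → R.l w ≤ R.l Y → R.r X ≤ R.r u ∧ R.l u ≤ R.l Y

/-- Quadruples of numbers up to `n`. -/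
def Bounded (n : ℕ) (q : Quad) : Prop := q.x < n + 1 ∧ q.y < n + 1 ∧ q.g < n + 1 ∧ q.f < n + 1

/-- The quadruples that can be reached in `k` steps. -/
def Advances (R : IntervalRep G) : ℕ → Quad → Prop
  | 0, q => Bounded n q ∧ q.x = n ∧ q.g = n ∧ q.f = 0
  | k + 1, q => Bounded n q ∧ ∃ p, R.Advances k p ∧ R.Advance p q

theorem Advances.bounded {R : IntervalRep G} {k : ℕ} {q : Quad} (h : R.Advances k q) :
    Bounded n q := by
  cases k with
  | zero => exact h.1
  | succ k => exact h.1

theorem Advances.exists_seq {R : IntervalRep G} {k : ℕ} {q : Quad} (h : R.Advances k q) :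
    ∃ s : ℕ → Quad, (s 0).x = n ∧ (s 0).g = n ∧ (s 0).f = 0 ∧ s k = q ∧
      ∀ j < k, R.Advance (s j) (s (j + 1)) := by
  induction k generalizing q with
  | zero => exact ⟨fun _ => q, h.2.1, h.2.2.1, h.2.2.2, rfl, fun j hj => by omega⟩
  | succ k ih =>
    obtain ⟨-, p, hp, hpq⟩ := h
    obtain ⟨s, h1, h2, h3, h4, h5⟩ := ih hp
    refine ⟨fun j => if j ≤ k then s j else q, by simpa using h1, by simpa using h2,
      by simpa using h3, by simp, fun j hj => ?_⟩
    by_cases e : j = k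
    · subst e
      simpa [h4] using hpq
    · have h6 : j ≤ k := by omega
      have h7 : j + 1 ≤ k := by omega
      simpa [h6, h7] using h5 j (by omega)

theorem advances_of_seq {R : IntervalRep G} {k : ℕ} (s : ℕ → Quad) (h : (s 0).x = n)
    (h' : (s 0).g = n) (h'' : (s 0).f = 0) (hb : ∀ j, Bounded n (s j))
    (hs : ∀ j < k, R.Advance (s j) (s (j + 1))) : R.Advances k (s k) := by
  induction k with
  | zero => exact ⟨hb 0, h, h', h''⟩
  | succ k ih => exact ⟨hb _, s k, ih fun j hj => hs j (by omega), hs k (by omega)⟩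

/-- Consecutive tokens suffice. -/
theorem exists_conf {R : IntervalRep G} {k : ℕ} (f : Fin k → Fin n)
    (h : ∀ i j : Fin k, i.val + 1 = j.val → R.r (f i) < R.l (f j)) :
    ∃ F : R.Conf k, F.1 = f := by
  have key : ∀ d : ℕ, ∀ i j : Fin k, i.val + d + 1 = j.val → R.r (f i) < R.l (f j) := by
    intro d
    induction d with
    | zero => exact fun i j hij => h i j hij
    | succ d ih =>
      intro i j hij
      have h1 := ih i ⟨i.val + d + 1, by omega⟩ rfl
      have h2 := h ⟨i.val + d + 1, by omega⟩ j (by simp only; omega)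
      exact (h1.trans_le (R.l_le_r _)).trans h2
  exact ⟨⟨f, fun i j hij => key (j.val - i.val - 1) i j (by
    have := Fin.lt_def.1 hij
    omega)⟩, rfl⟩

/-- A step guesses the right end of the next range, and the following step checks it. In the first
and the last step the value `n` is no vertex, so the conditions on the missing neighbours are
vacuous. -/
theorem Advances.exists_barrier {R : IntervalRep G} {k : ℕ} {q : Quad} (h : R.Advances k q)
    (hq : q.y = n) : ∃ (X : R.Conf k) (Y : Fin k → Fin n) (A : R.Conf k), R.Barrier X Y ∧
      (q.f ≠ 0 → ∃ j, R.r (A.1 j) < R.r (X.1 j)) := by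
  obtain ⟨s, hx, hg, hf, rfl, hs⟩ := h.exists_seq
  choose X Y A hX hY hA hXX hAA hXY hflag hclosed using fun j : Fin k => hs j.val j.2
  obtain ⟨X', rfl⟩ := exists_conf (R := R) X fun i j hij => hXX j _ (by rw [← hij, hX])
  obtain ⟨A', rfl⟩ := exists_conf (R := R) A fun i j hij => hAA j _ (by rw [← hij, hA])
  refine ⟨X', Y, A', ⟨hXY, ?_⟩, fun hf' => ?_⟩
  · intro j w u hw hu
    have left : ∀ w, R.Window X'.1 Y j w → ∀ v : Fin n, (s j.val).x = v → R.r v < R.l w := by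
      intro w hw v hv
      rcases Nat.eq_zero_or_pos j.val with h0 | h0
      · rw [h0, hx] at hv
        exact absurd hv v.2.ne'
      · have e : (⟨j.val - 1, by omega⟩ : Fin k).val + 1 = j.val := by simp only; omega
        have h1 := hX ⟨j.val - 1, by omega⟩
        rw [e, hv] at h1
        rw [Fin.ext h1]
        exact hw.1 _ e
    have right : ∀ w, R.Window X'.1 Y j w → ∀ v : Fin n, (s (j.val + 1)).y = v →
        R.r w < R.l v := by
      intro w hw v hv
      by_cases h0 : j.val + 1 = k
      · rw [h0, hq] at hv
        exact absurd hv v.2.ne'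
      · have h1 := hY ⟨j.val + 1, by omega⟩
        simp only at h1
        rw [hv] at h1
        rw [Fin.ext h1]
        exact hw.2 _ rfl
    exact hclosed j w u (left w hw) (left u hu) (right w hw) (right u hu)
  · by_contra! hc
    -- A flag can only become nonzero at a token of `A` to the left of its range; without such a
    -- token it stays zero.
    have : ∀ j ≤ k, (s j).f = 0 := by
      intro j
      induction j with
      | zero => exact fun _ => hf
      | succ j ih =>
        intro hj
        by_contra h1
        rcases hflag ⟨j, hj⟩ h1 with h2 | h2
        · exact h2 (ih (by omega))
        · exact absurd h2 (not_lt.2 (hc _))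
    exact hf' (this k le_rfl)

-- The quadruples can be read off: the ranges and the second configuration around the gap before
-- token `j`, with `n` where there is no token, and a flag that looks back at the earlier tokens.
open scoped Classical in
theorem Barrier.exists_advances {R : IntervalRep G} {k : ℕ} {X : R.Conf k} {Y : Fin k → Fin n}
    (h : R.Barrier X Y) (A : R.Conf k) : ∃ q, R.Advances k q ∧ q.y = n ∧
      ((∃ j, R.r (A.1 j) < R.r (X.1 j)) → q.f ≠ 0) := by
  let s (j : ℕ) : Quad :=
    { x := if h : 0 < j ∧ j ≤ k then X.1 ⟨j - 1, by omega⟩ else n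
      y := if h : j < k then Y ⟨j, h⟩ else n
      g := if h : 0 < j ∧ j ≤ k then A.1 ⟨j - 1, by omega⟩ else n
      f := if ∃ i : Fin k, i.val < j ∧ R.r (A.1 i) < R.r (X.1 i) then 1 else 0 }
  have hb : ∀ j, Bounded n (s j) := by
    intro j
    refine ⟨?_, ?_, ?_, ?_⟩
    · simp only [s]
      split_ifs <;> omega
    · simp only [s]
      split_ifs <;> omega
    · simp only [s]
      split_ifs <;> omega
    · simp only [s]
      split_ifs with h
      -- A flag `1` stems from a token, so there is a vertex and `1 ≤ n`.
      · obtain ⟨i, -⟩ := h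
        have := (X.1 i).2
        omega
      · omega
  have hxj : ∀ j : Fin k, (s (j.val + 1)).x = X.1 j := fun j => by
    have : 0 < j.val + 1 ∧ j.val + 1 ≤ k := ⟨by omega, j.2⟩
    simp only [s, dif_pos this]
    rfl
  have hgj : ∀ j : Fin k, (s (j.val + 1)).g = A.1 j := fun j => by
    have : 0 < j.val + 1 ∧ j.val + 1 ≤ k := ⟨by omega, j.2⟩
    simp only [s, dif_pos this]
    rfl
  have hyj : ∀ j : Fin k, (s j.val).y = Y j := fun j => by simp [s]
  refine ⟨s k, advances_of_seq s (by simp [s]) (by simp [s]) (by simp [s]) hb ?_, by simp [s], ?_⟩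
  · intro j hj
    have prev : ∀ (F : Fin k → Fin n) (t : ℕ → ℕ), t 0 = n → (∀ j : Fin k, t (j.val + 1) = F j) →
        ∀ v : Fin n, t j = v → ∃ i : Fin k, i.val + 1 = j ∧ F i = v := by
      intro F t h0 h1 v hv
      cases j with
      | zero =>
        rw [h0] at hv
        exact absurd hv v.2.ne'
      | succ j =>
        have := h1 ⟨j, by omega⟩
        simp only at this
        rw [hv] at this
        exact ⟨⟨j, by omega⟩, rfl, (Fin.ext this).symm⟩
    have prevX := prev X.1 (fun j => (s j).x) (by simp [s]) hxj
    have prevA := prev A.1 (fun j => (s j).g) (by simp [s]) hgj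
    refine ⟨X.1 ⟨j, hj⟩, Y ⟨j, hj⟩, A.1 ⟨j, hj⟩, hxj ⟨j, hj⟩, hyj ⟨j, hj⟩, hgj ⟨j, hj⟩,
      fun v hv => ?_, fun v hv => ?_, h.l_le _, fun hf => ?_, ?_⟩
    · obtain ⟨i, hi, rfl⟩ := prevX v hv
      exact X.2 _ _ (Fin.lt_def.2 (by simp only; omega))
    · obtain ⟨i, hi, rfl⟩ := prevA v hv
      exact A.2 _ _ (Fin.lt_def.2 (by simp only; omega))
    · have : ∃ i : Fin k, i.val < j + 1 ∧ R.r (A.1 i) < R.r (X.1 i) := by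
        by_contra hc
        exact hf (by simp only [s, if_neg hc])
      obtain ⟨i, hi, hlt⟩ := this
      by_cases e : i.val = j
      · right
        obtain rfl : i = ⟨j, hj⟩ := Fin.ext e
        exact hlt
      · left
        have : ∃ i : Fin k, i.val < j ∧ R.r (A.1 i) < R.r (X.1 i) := ⟨i, by omega, hlt⟩
        simp only [s, if_pos this]
        exact one_ne_zero
    · intro w u hw hu hw' hu'
      have win : ∀ w : Fin n, (∀ v : Fin n, (s j).x = v → R.r v < R.l w) →
          (∀ v : Fin n, (s (j + 1)).y = v → R.r w < R.l v) → R.Window X.1 Y ⟨j, hj⟩ w := by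
        intro w h1 h2
        refine ⟨fun i hi => h1 _ ?_, fun i hi => h2 _ ?_⟩
        · rw [← hxj i, hi]
        · rw [← hyj i, ← hi]
      exact h.closed ⟨j, hj⟩ w u (win w hw hw') (win u hu hu')
  · rintro ⟨j, hj⟩
    have : ∃ i : Fin k, i.val < k ∧ R.r (A.1 i) < R.r (X.1 i) := ⟨j, j.2, hj⟩
    simp only [s, if_pos this]
    exact one_ne_zero

theorem preconnected_iff_advances (R : IntervalRep G) (k : ℕ) :
    (TS G k).Preconnected ↔ ¬ ∃ q, R.Advances k q ∧ q.y = n ∧ q.f ≠ 0 := by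
  rw [← (R.slideIso k).preconnected_iff, ← not_iff_not, not_not, not_preconnected_iff]
  constructor
  · rintro ⟨X, Y, A, j, h, hj⟩
    obtain ⟨q, hq, hy, hf⟩ := h.exists_advances A
    exact ⟨q, hq, hy, hf ⟨j, hj⟩⟩
  · rintro ⟨q, hq, hy, hf⟩
    obtain ⟨X, Y, A, h, hj⟩ := hq.exists_barrier hy
    obtain ⟨j, hj⟩ := hj hf
    exact ⟨X, Y, A, j, h, hj⟩

theorem nonempty_iff_advances (R : IntervalRep G) (k : ℕ) :
    Nonempty (IndepSets G k) ↔ ∃ q, R.Advances k q ∧ q.y = n := by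
  rw [← (R.slideIso k).toEquiv.nonempty_congr]
  constructor
  · rintro ⟨f⟩
    obtain ⟨X, Y, h, -⟩ := R.exists_barrier f
    obtain ⟨q, hq, hy, -⟩ := h.exists_advances X
    exact ⟨q, hq, hy⟩
  · rintro ⟨q, hq, hy⟩
    obtain ⟨X, -⟩ := hq.exists_barrier hy
    exact ⟨X⟩

end IntervalRep

theorem isEmpty_indepSets {n k : ℕ} (G : SimpleGraph (Fin n)) (h : n < k) :
    IsEmpty (IndepSets G k) :=
  ⟨fun I => by
    have := Finset.card_le_univ I.1
    rw [I.2.card_eq, Fintype.card_fin] at this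
    omega⟩

/-- The expression is the minimum of `k` and `n + 1` in truncated subtraction. It bounds the number
of rounds independently of `k`, and beyond `n` there are no independent sets anyway. -/
theorem preconnected_min_iff {n k : ℕ} (G : SimpleGraph (Fin n)) :
    (TS G (k - (k - (n + 1)))).Preconnected ↔ (TS G k).Preconnected := by
  rcases le_or_gt k n with h | h
  · rw [show k - (k - (n + 1)) = k by omega]
  · have h1 := isEmpty_indepSets G h
    have h2 := isEmpty_indepSets G (show n < k - (k - (n + 1)) by omega)
    exact iff_of_true (fun I => h2.elim I) fun I => h1.elim I

theorem nonempty_min_iff {n k : ℕ} (G : SimpleGraph (Fin n)) :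
    Nonempty (IndepSets G (k - (k - (n + 1)))) ↔ Nonempty (IndepSets G k) := by
  rcases le_or_gt k n with h | h
  · rw [show k - (k - (n + 1)) = k by omega]
  · have h1 := isEmpty_indepSets G h
    have h2 := isEmpty_indepSets G (show n < k - (k - (n + 1)) by omega)
    exact iff_of_false (not_nonempty_iff.2 h2) (not_nonempty_iff.2 h1)

/-! ### Short walks -/

/-- There is a walk of length at most `2 ^ t`. -/
def Within {V : Type*} (H : SimpleGraph V) (t : ℕ) (a b : V) : Prop :=
  ∃ p : H.Walk a b, p.length ≤ 2 ^ t

theorem within_zero_iff {V : Type*} {H : SimpleGraph V} {a b : V} :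
    Within H 0 a b ↔ a = b ∨ H.Adj a b := by
  constructor
  · rintro ⟨p, hp⟩
    rw [pow_zero] at hp
    rcases Nat.le_one_iff_eq_zero_or_eq_one.1 hp with h | h
    · exact Or.inl (SimpleGraph.Walk.eq_of_length_eq_zero h)
    · exact Or.inr (SimpleGraph.Walk.adj_of_length_eq_one h)
  · rintro (rfl | h)
    · exact ⟨SimpleGraph.Walk.nil, by simp⟩
    · exact ⟨h.toWalk, by simp⟩

theorem within_succ_iff {V : Type*} {H : SimpleGraph V} {t : ℕ} {a b : V} :
    Within H (t + 1) a b ↔ ∃ c, Within H t a c ∧ Within H t c b := by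
  constructor
  · rintro ⟨p, hp⟩
    rw [pow_succ] at hp
    refine ⟨p.getVert (2 ^ t), ⟨p.take (2 ^ t), ?_⟩, ⟨p.drop (2 ^ t), ?_⟩⟩
    · rw [SimpleGraph.Walk.take_length]
      exact min_le_left _ _
    · rw [SimpleGraph.Walk.drop_length]
      omega
  · rintro ⟨c, ⟨p, hp⟩, ⟨q, hq⟩⟩
    refine ⟨p.append q, ?_⟩
    rw [SimpleGraph.Walk.length_append, pow_succ]
    omega

/-- A path has fewer than `n * n` edges, so `n + 1` doublings of the length suffice. -/
theorem within_iff_reachable {n : ℕ} {H : SimpleGraph (Fin n × Fin n)} {a b : Fin n × Fin n} :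
    Within H (n + 1) a b ↔ H.Reachable a b := by
  classical
  constructor
  · rintro ⟨p, -⟩
    exact p.reachable
  · intro h
    obtain ⟨p, hp⟩ := h.exists_isPath
    refine ⟨p, hp.length_lt.le.trans ?_⟩
    rw [Fintype.card_prod, Fintype.card_fin]
    -- The second inequality controls the increment of the square in the induction; it is claimed
    -- from `3` on, and the small cases are computed.
    have key : ∀ n : ℕ, n * n ≤ 2 ^ (n + 1) ∧ (3 ≤ n → 2 * n + 1 ≤ 2 ^ (n + 1)) := by
      intro n
      induction n with
      | zero => simp
      | succ m ih =>
        rw [pow_succ]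
        rcases Nat.lt_or_ge m 3 with h | h
        · interval_cases m <;> simp
        · have := ih.2 h
          exact ⟨by nlinarith [ih.1], fun _ => by omega⟩
    exact (key n).1

/-! ### The formulas of the algorithm -/

namespace Form

/-- Disjunction. -/
def or (φ ψ : Form) : Form := neg (and (neg φ) (neg ψ))

/-- Implication. -/
def imp (φ ψ : Form) : Form := neg (and φ (neg ψ))

/-- Bounded universal quantification. -/
def all (x : ℕ) (φ : Form) : Form := neg (ex x (neg φ))

/-- The value of `x` is less than the value of `y`. -/
def lt (x y : ℕ) : Form := test (Expr.sub (Expr.var y) (Expr.var x))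

/-- The values of `x` and `y` are equal. -/
def eq (x y : ℕ) : Form := and (neg (lt x y)) (neg (lt y x))

/-- The value of `x` is not zero. -/
def pos (x : ℕ) : Form := test (Expr.var x)

/-- Membership in the relation stored in array `b`. -/
def rel (b x y z w : ℕ) : Form := test (Expr.read b (quad x y z w))

/-- Adjacency; variable `4` holds the number of vertices, and array `2` its multiples. -/
def edge (x y : ℕ) : Form :=
  and (lt x 4) (and (lt y 4)
    (test (Expr.read 0 (Expr.add (Expr.read 2 (Expr.var x)) (Expr.var y)))))

theorem sat_or {φ ψ : Form} {s : State} : (or φ ψ).Sat s ↔ φ.Sat s ∨ ψ.Sat s := by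
  simp only [or, Sat]
  tauto

theorem sat_imp {φ ψ : Form} {s : State} : (imp φ ψ).Sat s ↔ (φ.Sat s → ψ.Sat s) := by
  simp only [imp, Sat]
  tauto

theorem sat_all {x : ℕ} {φ : Form} {s : State} :
    (all x φ).Sat s ↔ ∀ v < s.var 3, φ.Sat (s.set x v) := by
  simp only [all, Sat]
  push Not
  rfl

theorem sat_lt {x y : ℕ} {s : State} : (lt x y).Sat s ↔ s.var x < s.var y := by
  simp only [lt, Sat, Expr.eval]
  omega

theorem sat_eq {x y : ℕ} {s : State} : (eq x y).Sat s ↔ s.var x = s.var y := by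
  simp only [eq, Sat, sat_lt]
  omega

theorem sat_pos {x : ℕ} {s : State} : (pos x).Sat s ↔ s.var x ≠ 0 := Iff.rfl

theorem sat_rel {b x y z w : ℕ} {s : State} :
    (rel b x y z w).Sat s ↔ Tab s b (s.var x) (s.var y) (s.var z) (s.var w) := Iff.rfl

end Form

/-- Adjacency as read from memory. -/
def EdgeAt (s : State) (m x y : ℕ) : Prop := x < m ∧ y < m ∧ s.arr 0 (s.arr 2 x + y) ≠ 0

theorem Form.sat_edge {x y : ℕ} {s : State} :
    (edge x y).Sat s ↔ EdgeAt s (s.var 4) (s.var x) (s.var y) := by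
  simp only [edge, Sat, sat_lt, EdgeAt]
  rfl

theorem tab_set (s : State) (x v b a c d e : ℕ) :
    Tab (s.set x v) b a c d e ↔ Tab s b a c d e := Iff.rfl

theorem edgeAt_set (s : State) (x v m a b : ℕ) :
    EdgeAt (s.set x v) m a b ↔ EdgeAt s m a b := Iff.rfl

namespace Form

/-- Distinct and not adjacent. -/
def apart (x y : ℕ) : Form :=
  and (lt x 4) (and (lt y 4) (and (neg (eq x y)) (neg (edge x y))))

/-- Pairs that are equal or related by the forcing relation. -/
def forced (a b c d : ℕ) : Form :=
  or (and (eq a c) (eq b d)) (and (apart a b) (and (apart c d)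
    (or (and (eq a c) (edge b d)) (and (eq b d) (edge a c)))))

/-- Composition of the relation in array `3` with itself. -/
def square : Form := ex 14 (ex 15 (and (rel 3 10 11 14 15) (rel 3 14 15 12 13)))

/-- The lexicographic orientation, extended by the boundary. -/
def order : Form :=
  or (and (eq 10 4) (lt 11 4)) (or (and (eq 11 4) (lt 10 4)) (and (apart 10 11)
    (ex 14 (ex 15 (and (rel 3 10 11 14 15) (all 16 (all 17 (imp (rel 3 11 10 16 17)
      (or (lt 14 16) (and (eq 14 16) (lt 15 17)))))))))))

/-- The order stored in array `5`. -/
def prec (x y : ℕ) : Form := rel 5 x y y y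

/-- Comparison of left end points. -/
def leftLe (v x y : ℕ) : Form := all v (imp (prec v x) (prec v y))

/-- Comparison of right end points. -/
def rightLe (v x y : ℕ) : Form := all v (imp (prec y v) (prec x v))

/-- The quadruple `(10, 11, 12, 13)` is a start of a sequence. -/
def start : Form := and (eq 10 4) (and (eq 12 4) (neg (pos 13)))

/-- The quadruple `(10, 11, 12, 13)` can be reached in one step from a quadruple in array `6`. -/
def advance : Form := ex 14 (ex 15 (ex 16 (ex 17 (and (rel 6 14 15 16 17)
  (and (lt 10 4) (and (lt 12 4) (and (lt 15 4) (and (prec 14 10) (and (prec 16 12)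
  (and (leftLe 18 10 15) (and (imp (pos 13) (or (pos 17) (neg (rightLe 18 10 12))))
  (all 18 (all 19 (imp (and (prec 14 18) (and (prec 14 19) (and (prec 18 11) (and (prec 19 11)
    (and (edge 18 19) (and (rightLe 20 10 18) (leftLe 20 18 15)))))))
    (and (rightLe 20 10 19) (leftLe 20 19 15))))))))))))))))

/-- Copy array `b`. -/
def copy (b : ℕ) : Form := rel b 10 11 12 13

/-- No barrier with a flag has been found. -/
def noFlag : Form := neg (ex 10 (ex 11 (ex 12 (and (rel 6 10 4 11 12) (pos 12)))))

/-- Some barrier has been found. -/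
def someBarrier : Form := ex 10 (ex 11 (ex 12 (rel 6 10 4 11 12)))

end Form

/-! ### Tables that hold the intended relations -/

/-- Array `b` holds the relation `P` on the numbers below `N`. -/
def Holds (N : ℕ) (s : State) (b : ℕ) (P : ℕ → ℕ → ℕ → ℕ → Prop) : Prop :=
  ∀ x < N, ∀ y < N, ∀ z < N, ∀ w < N, Tab s b x y z w ↔ P x y z w

theorem Holds.congr {N : ℕ} {s s' : State} {b : ℕ} {P : ℕ → ℕ → ℕ → ℕ → Prop}
    (h : Holds N s b P) (h1 : s'.arr 1 = s.arr 1) (hb : s'.arr b = s.arr b) : Holds N s' b P := by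
  intro x hx y hy z hz w hw
  rw [← h x hx y hy z hz w hw, Tab, Tab, h1, hb]

/-- The memory after the preparations: the number of vertices, the number of rounds, the
multiplication tables and the adjacency matrix. -/
def Prepared {n : ℕ} (G : SimpleGraph (Fin n)) (K : ℕ) (s : State) : Prop :=
  Ready (n + 1) s ∧ s.var 4 = n ∧ s.var 5 = K ∧
    ∀ u v : Fin n, s.arr 0 (s.arr 2 u + v) ≠ 0 ↔ G.Adj u v

theorem Prepared.congr {n K : ℕ} {G : SimpleGraph (Fin n)} {s s' : State} (h : Prepared G K s)
    (hv : ∀ i < 6, i ≠ 2 → s'.var i = s.var i) (ha : ∀ a < 3, s'.arr a = s.arr a) :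
    Prepared G K s' := by
  obtain ⟨⟨h1, h2⟩, h3, h4, h5⟩ := h
  refine ⟨⟨by rw [hv 3 (by decide) (by decide), h1], ?_⟩,
    by rw [hv 4 (by decide) (by decide), h3], by rw [hv 5 (by decide) (by decide), h4], ?_⟩
  · rw [ha 1 (by decide)]
    exact h2
  · rw [ha 0 (by decide), ha 2 (by decide)]
    exact h5

theorem Prepared.edgeAt_iff {n K : ℕ} {G : SimpleGraph (Fin n)} {s : State}
    (h : Prepared G K s) (x y : ℕ) :
    EdgeAt s n x y ↔ ∃ u v : Fin n, x = u ∧ y = v ∧ G.Adj u v := by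
  constructor
  · rintro ⟨hx, hy, h'⟩
    exact ⟨⟨x, hx⟩, ⟨y, hy⟩, rfl, rfl, (h.2.2.2 ⟨x, hx⟩ ⟨y, hy⟩).1 h'⟩
  · rintro ⟨u, v, rfl, rfl, h'⟩
    exact ⟨u.2, v.2, (h.2.2.2 u v).2 h'⟩

theorem Prepared.edgeAt_coe {n K : ℕ} {G : SimpleGraph (Fin n)} {s : State}
    (h : Prepared G K s) (u v : Fin n) : EdgeAt s n u v ↔ G.Adj u v :=
  ⟨fun h' => (h.2.2.2 u v).1 h'.2.2, fun h' => ⟨u.2, v.2, (h.2.2.2 u v).2 h'⟩⟩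

/-- Rounds of a computation with two buffers `b` and `b'`. -/
theorem Total.iterate_fill {b b' m M N : ℕ} {ψ : Form} {s : State}
    (hb : 3 ≤ b) (hb' : 3 ≤ b')
    (hψ : ψ.Scoped b' 14) (hcopy : (Form.copy b').Scoped b 14)
    (Pre : State → Prop) (P : ℕ → ℕ → ℕ → ℕ → ℕ → Prop)
    (stable : ∀ s s', (∀ i < 6, i ≠ 2 → s'.var i = s.var i) →
      (∀ a, a ≠ b → a ≠ b' → s'.arr a = s.arr a) → Pre s → Pre s')
    (ready : ∀ s, Pre s → Ready N s) (hM : ∀ s, Pre s → s.var m = M)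
    (step : ∀ t s, Pre s → Holds N s b (P t) → ∀ x < N, ∀ y < N, ∀ z < N, ∀ w < N,
      ψ.Sat (s.args x y z w) ↔ P (t + 1) x y z w)
    (hs : Pre s) (h0 : Holds N s b (P 0)) :
    Total (Prog.forBelow 6 m (Prog.seq (TokenSliding.fill b' ψ) (TokenSliding.fill b (Form.copy b')))) s
      (6 + M * (fillTime ψ N + fillTime (Form.copy b') N + 8))
      fun s' => Pre s' ∧ Holds N s' b (P M) := by
  have main := Total.forLoop_iterate (x := 6) (m := m) (a := 1)
    (p := Prog.seq (TokenSliding.fill b' ψ) (TokenSliding.fill b (Form.copy b')))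
    (T := fillTime ψ N + fillTime (Form.copy b') N)
    (fun t s' => Pre s' ∧ Holds N s' b (P t)) (fun t s' h => hM s' h.1)
    (fun t s' c h => ⟨stable _ _ (fun i hi _ => State.set_var_of_ne _ _ (by omega))
      (fun _ _ _ => rfl) h.1, h.2.congr rfl rfl⟩)
    (fun t s₁ h => by
      refine Total.seq ((Total.fill (by omega) hψ (ready s₁ h.1)).mono le_rfl ?_)
      rintro s₂ ⟨a₂, t₂⟩
      have p₂ : Pre s₂ := stable _ _ (fun i hi => a₂.1 i (by omega))
        (fun a _ ha => a₂.2 a ha) h.1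
      refine (Total.fill (by omega) hcopy (ready s₂ p₂)).mono le_rfl ?_
      rintro s₃ ⟨a₃, t₃⟩
      refine ⟨fun i hi hi2 => (a₃.1 i (by omega) hi2).trans (a₂.1 i (by omega) hi2),
        stable _ _ (fun i hi => a₃.1 i (by omega)) (fun a ha _ => a₃.2 a ha) p₂, ?_⟩
      intro x hx y hy z hz w hw
      rw [t₃ x hx y hy z hz w hw, ← step t s₁ h.1 h.2 x hx y hy z hz w hw,
        ← t₂ x hx y hy z hz w hw]
      exact Form.sat_rel)
    (by decide) 0 s ⟨hs, h0⟩
  refine main.mono le_rfl ?_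
  rintro s' ⟨-, h1, h2⟩
  exact ⟨h1, by simpa using h2⟩

/-! ### Correctness of the formulas -/

section Formulas

variable {n K : ℕ} {G : SimpleGraph (Fin n)} {s : State}

/-- The numbers stand for pairs of vertices at bounded distance. -/
def ClassRel (G : SimpleGraph (Fin n)) (t x y z w : ℕ) : Prop :=
  (x = z ∧ y = w) ∨ ∃ a b c d : Fin n, x = a ∧ y = b ∧ z = c ∧ w = d ∧
    Within (forcing G) t (a, b) (c, d)

theorem sat_apart_iff (h : Prepared G K s) (x y : ℕ) :
    (x < n ∧ y < n ∧ ¬ x = y ∧ ¬ EdgeAt s n x y) ↔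
      ∃ u v : Fin n, x = u ∧ y = v ∧ Apart G u v := by
  constructor
  · rintro ⟨hx, hy, hne, he⟩
    exact ⟨⟨x, hx⟩, ⟨y, hy⟩, rfl, rfl, fun e => hne (congrArg Fin.val e),
      fun ha => he ((h.edgeAt_coe ⟨x, hx⟩ ⟨y, hy⟩).2 ha)⟩
  · rintro ⟨u, v, rfl, rfl, hne, ha⟩
    exact ⟨u.2, v.2, fun e => hne (Fin.ext e), fun he => ha ((h.edgeAt_coe u v).1 he)⟩

theorem sat_forced_iff (h : Prepared G K s) (x y z w : ℕ) :
    (Form.forced 10 11 12 13).Sat (s.args x y z w) ↔ ClassRel G 0 x y z w := by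
  simp only [Form.forced, Form.apart, Form.Sat, Form.sat_or, Form.sat_eq, Form.sat_lt,
    Form.sat_edge, State.args, State.set_var, edgeAt_set, h.2.1, Nat.reduceEqDiff, reduceIte]
  rw [sat_apart_iff h, sat_apart_iff h, ClassRel]
  refine or_congr_right' fun hne => ⟨?_, ?_⟩
  · rintro ⟨⟨a, b, rfl, rfl, hab⟩, ⟨c, d, rfl, rfl, hcd⟩, h'⟩
    refine ⟨a, b, c, d, rfl, rfl, rfl, rfl, within_zero_iff.2 (Or.inr ⟨hab, hcd, ?_⟩)⟩
    rw [h.edgeAt_coe, h.edgeAt_coe] at h'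
    exact h'.imp (fun h => ⟨Fin.ext h.1, h.2⟩) fun h => ⟨Fin.ext h.1, h.2⟩
  · rintro ⟨a, b, c, d, rfl, rfl, rfl, rfl, h'⟩
    rcases within_zero_iff.1 h' with h' | ⟨hab, hcd, h'⟩
    · obtain ⟨rfl, rfl⟩ := Prod.ext_iff.1 h'
      exact absurd ⟨rfl, rfl⟩ hne
    · refine ⟨⟨a, b, rfl, rfl, hab⟩, ⟨c, d, rfl, rfl, hcd⟩, ?_⟩
      rw [h.edgeAt_coe, h.edgeAt_coe]
      exact h'.imp (fun h => ⟨congrArg Fin.val h.1, h.2⟩) fun h => ⟨congrArg Fin.val h.1, h.2⟩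

theorem Within.succ {V : Type*} {H : SimpleGraph V} {t : ℕ} {a b : V} (h : Within H t a b) :
    Within H (t + 1) a b :=
  within_succ_iff.2 ⟨a, ⟨SimpleGraph.Walk.nil, by simp⟩, h⟩

theorem sat_square_iff (h : Prepared G K s) {t : ℕ} (hC : Holds (n + 1) s 3 (ClassRel G t))
    {x y z w : ℕ} (hx : x < n + 1) (hy : y < n + 1) (hz : z < n + 1) (hw : w < n + 1) :
    Form.square.Sat (s.args x y z w) ↔ ClassRel G (t + 1) x y z w := by
  simp only [Form.square, Form.Sat, Form.sat_rel, State.args, State.set_var, tab_set, h.1.1,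
    Nat.reduceEqDiff, reduceIte]
  constructor
  · rintro ⟨u, hu, v, hv, h1, h2⟩
    rw [hC x hx y hy u hu v hv] at h1
    rw [hC u hu v hv z hz w hw] at h2
    rcases h1 with ⟨rfl, rfl⟩ | ⟨a, b, c, d, rfl, rfl, rfl, rfl, h1⟩
    · rcases h2 with h2 | ⟨a, b, c, d, e1, e2, e3, e4, h2⟩
      · exact Or.inl h2
      · exact Or.inr ⟨a, b, c, d, e1, e2, e3, e4, h2.succ⟩
    · rcases h2 with ⟨rfl, rfl⟩ | ⟨a', b', c', d', e1, e2, e3, e4, h2⟩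
      · exact Or.inr ⟨a, b, c, d, rfl, rfl, rfl, rfl, h1.succ⟩
      · rw [← Fin.ext e1, ← Fin.ext e2] at h2
        exact Or.inr ⟨a, b, c', d', rfl, rfl, e3, e4, within_succ_iff.2 ⟨_, h1, h2⟩⟩
  · rintro (⟨rfl, rfl⟩ | ⟨a, b, c, d, rfl, rfl, rfl, rfl, h'⟩)
    · exact ⟨x, hx, y, hy, (hC x hx y hy x hx y hy).2 (Or.inl ⟨rfl, rfl⟩),
        (hC x hx y hy x hx y hy).2 (Or.inl ⟨rfl, rfl⟩)⟩
    · obtain ⟨⟨u, v⟩, h1, h2⟩ := within_succ_iff.1 h'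
      exact ⟨u, by omega, v, by omega,
        (hC _ hx _ hy _ (by omega) _ (by omega)).2 (Or.inr ⟨a, b, u, v, rfl, rfl, rfl, rfl, h1⟩),
        (hC _ (by omega) _ (by omega) _ hz _ hw).2
          (Or.inr ⟨u, v, c, d, rfl, rfl, rfl, rfl, h2⟩)⟩

/-- The lexicographic orientation, extended by the boundary `n`. -/
def OrderRel (G : SimpleGraph (Fin n)) (x y : ℕ) : Prop :=
  (x = n ∧ y < n) ∨ (y = n ∧ x < n) ∨ ∃ u v : Fin n, x = u ∧ y = v ∧ LexOrient G u v

theorem classRel_coe_iff {a b : Fin n} {z w : ℕ} :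
    ClassRel G (n + 1) a b z w ↔
      ∃ c d : Fin n, z = c ∧ w = d ∧ (forcing G).Reachable (a, b) (c, d) := by
  constructor
  · rintro (⟨rfl, rfl⟩ | ⟨a', b', c, d, e1, e2, e3, e4, h⟩)
    · exact ⟨a, b, rfl, rfl, SimpleGraph.Reachable.refl _⟩
    · rw [← Fin.ext e1, ← Fin.ext e2, within_iff_reachable] at h
      exact ⟨c, d, e3, e4, h⟩
  · rintro ⟨c, d, rfl, rfl, h⟩
    exact Or.inr ⟨a, b, c, d, rfl, rfl, rfl, rfl, within_iff_reachable.2 h⟩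

theorem sat_order_iff (h : Prepared G K s) (hC : Holds (n + 1) s 3 (ClassRel G (n + 1)))
    {x y : ℕ} (z w : ℕ) (hx : x < n + 1) (hy : y < n + 1) :
    Form.order.Sat (s.args x y z w) ↔ OrderRel G x y := by
  simp only [Form.order, Form.apart, Form.Sat, Form.sat_or, Form.sat_all, Form.sat_imp,
    Form.sat_eq, Form.sat_lt, Form.sat_edge, Form.sat_rel, State.args, State.set_var, tab_set,
    edgeAt_set, h.1.1, h.2.1, Nat.reduceEqDiff, reduceIte]
  rw [sat_apart_iff h, OrderRel]
  refine or_congr_right (or_congr_right ⟨?_, ?_⟩)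
  · rintro ⟨⟨u, v, rfl, rfl, huv⟩, p, hp, q, hq, hpq, hmin⟩
    rw [hC _ hx _ hy _ hp _ hq, classRel_coe_iff] at hpq
    obtain ⟨c, d, rfl, rfl, hr⟩ := hpq
    refine ⟨u, v, rfl, rfl, huv, (c, d), hr, ?_⟩
    rintro ⟨c', d'⟩ hr'
    have := hmin c' (by omega) d' (by omega)
      ((hC _ hy _ hx _ (by omega) _ (by omega)).2 (classRel_coe_iff.2 ⟨c', d', rfl, rfl, hr'⟩))
    exact this.imp Fin.lt_def.2 fun h => ⟨Fin.ext h.1, Fin.lt_def.2 h.2⟩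
  · rintro ⟨u, v, rfl, rfl, huv, ⟨c, d⟩, hr, hmin⟩
    refine ⟨⟨u, v, rfl, rfl, huv⟩, c, by omega, d, by omega,
      (hC _ hx _ hy _ (by omega) _ (by omega)).2 (classRel_coe_iff.2 ⟨c, d, rfl, rfl, hr⟩), ?_⟩
    intro p hp q hq hpq
    rw [hC _ hy _ hx _ hp _ hq, classRel_coe_iff] at hpq
    obtain ⟨c', d', rfl, rfl, hr'⟩ := hpq
    exact (hmin (c', d') hr').imp Fin.lt_def.1 fun h => ⟨congrArg Fin.val h.1, Fin.lt_def.1 h.2⟩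

/-- A representation whose order is the lexicographic orientation and whose end points are
determined by it. -/
def Canonical (R : IntervalRep G) : Prop :=
  (∀ u v, R.r u < R.l v ↔ LexOrient G u v) ∧
    (∀ u v, (∀ w, LexOrient G w u → LexOrient G w v) → R.l u ≤ R.l v) ∧
    ∀ u v, (∀ w, LexOrient G v w → LexOrient G u w) → R.r u ≤ R.r v

section Order

variable {R : IntervalRep G} (hR : Canonical R)
include hR

/-- Since `n` precedes every vertex, a single table entry expresses a condition that is to be
vacuous at the boundary. -/
theorem orderRel_left_iff {x : ℕ} (hx : x < n + 1) (w : Fin n) :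
    OrderRel G x w ↔ ∀ v : Fin n, x = v → R.r v < R.l w := by
  constructor
  · rintro (⟨rfl, -⟩ | ⟨h, -⟩ | ⟨u, v, rfl, e, h⟩) a ha
    · exact absurd ha a.2.ne'
    · exact absurd h w.2.ne
    · rw [Fin.ext e, ← Fin.ext ha]
      exact (hR.1 u v).2 h
  · intro h
    rcases Nat.lt_succ_iff_lt_or_eq.1 hx with h' | h'
    · exact Or.inr (Or.inr ⟨⟨x, h'⟩, w, rfl, rfl, (hR.1 _ _).1 (h ⟨x, h'⟩ rfl)⟩)
    · exact Or.inl ⟨h', w.2⟩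

theorem orderRel_right_iff {y : ℕ} (hy : y < n + 1) (w : Fin n) :
    OrderRel G w y ↔ ∀ v : Fin n, y = v → R.r w < R.l v := by
  constructor
  · rintro (⟨h, -⟩ | ⟨rfl, -⟩ | ⟨u, v, e, rfl, h⟩) a ha
    · exact absurd h w.2.ne
    · exact absurd ha a.2.ne'
    · rw [Fin.ext e, ← Fin.ext ha]
      exact (hR.1 u v).2 h
  · intro h
    rcases Nat.lt_succ_iff_lt_or_eq.1 hy with h' | h'
    · exact Or.inr (Or.inr ⟨w, ⟨y, h'⟩, rfl, rfl, (hR.1 _ _).1 (h ⟨y, h'⟩ rfl)⟩)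
    · exact Or.inr (Or.inl ⟨h', w.2⟩)

/-- In a canonical representation inclusion of the sets of predecessors decides the comparison of
left ends; the boundary precedes all vertices and does no harm. -/
theorem orderRel_leftLe_iff (u v : Fin n) :
    (∀ z < n + 1, OrderRel G z u → OrderRel G z v) ↔ R.l u ≤ R.l v := by
  constructor
  · refine fun h => hR.2.1 u v fun w hw => ?_
    have := h w (by omega) (Or.inr (Or.inr ⟨w, u, rfl, rfl, hw⟩))
    exact (hR.1 _ _).1 ((orderRel_left_iff hR (by omega) v).1 this w rfl)
  · intro h z hz hzu
    rw [orderRel_left_iff hR hz] at hzu ⊢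
    exact fun a ha => (hzu a ha).trans_le h

theorem orderRel_rightLe_iff (u v : Fin n) :
    (∀ z < n + 1, OrderRel G v z → OrderRel G u z) ↔ R.r u ≤ R.r v := by
  constructor
  · refine fun h => hR.2.2 u v fun w hw => ?_
    have := h w (by omega) (Or.inr (Or.inr ⟨v, w, rfl, rfl, hw⟩))
    exact (hR.1 _ _).1 ((orderRel_right_iff hR (by omega) u).1 this w rfl)
  · intro h z hz hzu
    rw [orderRel_right_iff hR hz] at hzu ⊢
    exact fun a ha => h.trans_lt (hzu a ha)

theorem sat_advance_iff (h : Prepared G K s)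
    (hO : Holds (n + 1) s 5 fun x y _ _ => OrderRel G x y) {t : ℕ}
    (hS : Holds (n + 1) s 6 fun x y g f => R.Advances t ⟨x, y, g, f⟩)
    {x y g f : ℕ} (hx : x < n + 1) (hy : y < n + 1) (hg : g < n + 1) (hf : f < n + 1) :
    Form.advance.Sat (s.args x y g f) ↔ R.Advances (t + 1) ⟨x, y, g, f⟩ := by
  -- The order occupies a table of quadruples in which the last two entries are irrelevant;
  -- `Form.prec` fills them by repetition.
  have hO' : ∀ {a b : ℕ}, a < n + 1 → b < n + 1 → (Tab s 5 a b b b ↔ OrderRel G a b) :=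
    fun ha hb => hO _ ha _ hb _ hb _ hb
  have hL : ∀ u v : Fin n, (∀ z < n + 1, Tab s 5 z u u u → Tab s 5 z v v v) ↔
      R.l u ≤ R.l v := fun u v => by
    rw [← orderRel_leftLe_iff hR]
    exact forall₂_congr fun z hz => by rw [hO' hz (by omega), hO' hz (by omega)]
  have hr : ∀ u v : Fin n, (∀ z < n + 1, Tab s 5 v z z z → Tab s 5 u z z z) ↔
      R.r u ≤ R.r v := fun u v => by
    rw [← orderRel_rightLe_iff hR]
    exact forall₂_congr fun z hz => by rw [hO' (by omega) hz, hO' (by omega) hz]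
  have hleft : ∀ {a : ℕ}, a < n + 1 → ∀ w : Fin n, Tab s 5 a w w w ↔
      ∀ v : Fin n, a = v → R.r v < R.l w := fun ha w => by
    rw [hO' ha (by omega), orderRel_left_iff hR ha]
  have hright : ∀ {a : ℕ}, a < n + 1 → ∀ w : Fin n, Tab s 5 w a a a ↔
      ∀ v : Fin n, a = v → R.r w < R.l v := fun ha w => by
    rw [hO' (by omega) ha, orderRel_right_iff hR ha]
  simp only [Form.advance, Form.prec, Form.leftLe, Form.rightLe, Form.Sat, Form.sat_or,
    Form.sat_all, Form.sat_imp, Form.sat_lt, Form.sat_edge, Form.sat_rel, Form.sat_pos,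
    State.args, State.set_var, tab_set, edgeAt_set, h.1.1, h.2.1, Nat.reduceEqDiff, reduceIte]
  constructor
  · rintro ⟨x₀, hx₀, y₀, hy₀, g₀, hg₀, f₀, hf₀, h1, hxn, hgn, hyn, h2, h3, h4, h5, h6⟩
    refine ⟨⟨hx, hy, hg, hf⟩, ⟨x₀, y₀, g₀, f₀⟩, (hS _ hx₀ _ hy₀ _ hg₀ _ hf₀).1 h1,
      ⟨x, hxn⟩, ⟨y₀, hyn⟩, ⟨g, hgn⟩, rfl, rfl, rfl, (hleft hx₀ ⟨x, hxn⟩).1 h2,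
      (hleft hg₀ ⟨g, hgn⟩).1 h3, (hL ⟨x, hxn⟩ ⟨y₀, hyn⟩).1 h4,
      fun h => (h5 h).imp_right fun h => not_le.1 fun h' => h ((hr ⟨x, hxn⟩ ⟨g, hgn⟩).2 h'), ?_⟩
    intro w u a1 a2 a3 a4 a5 a6 a7
    have := h6 w (by omega) u (by omega) ⟨(hleft hx₀ w).2 a1, (hleft hx₀ u).2 a2,
      (hright hy w).2 a3, (hright hy u).2 a4, (h.edgeAt_coe w u).2 a5,
      (hr ⟨x, hxn⟩ w).2 a6, (hL w ⟨y₀, hyn⟩).2 a7⟩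
    exact ⟨(hr ⟨x, hxn⟩ u).1 this.1, (hL u ⟨y₀, hyn⟩).1 this.2⟩
  · rintro ⟨-, ⟨x₀, y₀, g₀, f₀⟩, h1, X, Y, A, hX, hY, hA, h2, h3, h4, h5, h6⟩
    obtain ⟨hx₀, hy₀, hg₀, hf₀⟩ := h1.bounded
    dsimp only at hX hY hA h2 h3 h5 h6 hx₀ hy₀ hg₀ hf₀
    subst hX hY hA
    refine ⟨x₀, hx₀, Y, hy₀, g₀, hg₀, f₀, hf₀, (hS _ hx₀ _ hy₀ _ hg₀ _ hf₀).2 h1, X.2, A.2, Y.2,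
      (hleft hx₀ X).2 h2, (hleft hg₀ A).2 h3, (hL X Y).2 h4,
      fun h => (h5 h).imp_right fun h h' => absurd ((hr X A).1 h') (not_le.2 h), ?_⟩
    rintro w hw u hu ⟨a1, a2, a3, a4, a5, a6, a7⟩
    obtain ⟨w, u, rfl, rfl, hwu⟩ := (h.edgeAt_iff _ _).1 a5
    have := h6 w u ((hleft hx₀ w).1 a1) ((hleft hx₀ u).1 a2) ((hright hy w).1 a3)
      ((hright hy u).1 a4) hwu ((hr X w).1 a6) ((hL w Y).1 a7)
    exact ⟨(hr X u).2 this.1, (hL u Y).2 this.2⟩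

end Order

theorem sat_start_iff (R : IntervalRep G) (h : Prepared G K s) {x y g f : ℕ} (hx : x < n + 1)
    (hy : y < n + 1) (hg : g < n + 1) (hf : f < n + 1) :
    Form.start.Sat (s.args x y g f) ↔ R.Advances 0 ⟨x, y, g, f⟩ := by
  simp only [Form.start, Form.Sat, Form.sat_eq, Form.sat_pos, State.args, State.set_var, h.2.1,
    Nat.reduceEqDiff, reduceIte, not_not]
  exact ⟨fun h' => ⟨⟨hx, hy, hg, hf⟩, h'⟩, fun h' => h'.2⟩

end Formulas

/-! ### The algorithm -/

/-- Store the number of vertices, the number of rounds and the multiplication tables. -/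
def prepare : Prog :=
  Prog.seq (Prog.assign 3 (Expr.add (Expr.var 0) (Expr.lit 1)))
    (Prog.seq (Prog.assign 4 (Expr.var 0))
      (Prog.seq (Prog.assign 5 (Expr.sub (Expr.var 1) (Expr.sub (Expr.var 1) (Expr.var 3))))
        (Prog.seq (multiples 1 3) (multiples 2 4))))

/-- Compute all tables and evaluate `φ`. -/
def decider (φ : Form) : Prog :=
  Prog.seq prepare (Prog.seq (fill 3 (Form.forced 10 11 12 13))
    (Prog.seq (Prog.forBelow 6 3 (Prog.seq (fill 4 Form.square) (fill 3 (Form.copy 4))))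
    (Prog.seq (fill 5 Form.order) (Prog.seq (fill 6 Form.start)
    (Prog.seq (Prog.forBelow 6 5 (Prog.seq (fill 7 Form.advance) (fill 6 (Form.copy 7))))
    (Prog.seq φ.comp (Prog.assign 0 (Expr.var 2))))))))

/-- A bound for the running time of `prepare`. -/
def prepareTime (N : ℕ) : ℕ := 4 + (2 + (6 + (multiplesTime N + multiplesTime N)))

/-- A bound for the running time of `decider`. -/
def deciderTime (φ : Form) (N : ℕ) : ℕ :=
  prepareTime N + (fillTime (Form.forced 10 11 12 13) N +
    ((6 + N * (fillTime Form.square N + fillTime (Form.copy 4) N + 8)) +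
    (fillTime Form.order N + (fillTime Form.start N +
    ((6 + N * (fillTime Form.advance N + fillTime (Form.copy 7) N + 8)) +
    (φ.time N + 2))))))

theorem PolyBounded.deciderTime (φ : Form) : PolyBounded (deciderTime φ) := by
  have h1 : PolyBounded prepareTime :=
    (const 4).add ((const 2).add ((const 6).add (multiplesTime.add multiplesTime)))
  have h2 : ∀ ψ χ : Form, PolyBounded fun N =>
      6 + N * (TokenSliding.fillTime ψ N + TokenSliding.fillTime χ N + 8) := fun ψ χ =>
    (const 6).add (id.mul (((fillTime ψ).add (fillTime χ)).add (const 8)))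
  exact h1.add ((fillTime _).add ((h2 _ _).add ((fillTime _).add ((fillTime _).add
    ((h2 _ _).add ((formTime φ).add (const 2)))))))

section

variable {n : ℕ} (G : SimpleGraph (Fin n)) (k : ℕ)

/-- The cell determines the pair by uniqueness of digits in base `n`; two leading zeros bring it
into the form of `code`. -/
theorem input_adj_iff (u v : Fin n) : (input G k).arr 0 (u * n + v) ≠ 0 ↔ G.Adj u v := by
  classical
  have h : (∃ u' v' : Fin n, u.val * n + v.val = u'.val * n + v'.val ∧ G.Adj u' v') ↔
      G.Adj u v := by
    constructor
    · rintro ⟨u', v', h, h'⟩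
      have h1 : code n 0 0 u v = code n 0 0 u' v' := by simpa [code] using h
      obtain ⟨-, -, hu, hv⟩ := code_inj (by omega) u.2 v.2 (by omega) u'.2 v'.2 h1
      rwa [Fin.ext hu, Fin.ext hv]
    · exact fun h => ⟨u, v, rfl, h⟩
  simp [input, h]

theorem prepare_total : Total prepare (input G k) (prepareTime (n + 1))
    (Prepared G (k - (k - (n + 1)))) := by
  refine Total.seq (T := 4) (Total.assign (Total.seq (T := 2) (Total.assign
    (Total.seq (T := 6) (Total.assign ?_)))))
  let s₀ : State := (((input G k).set 3 (n + 1)).set 4 n).set 5 (k - (k - (n + 1)))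
  change Total _ s₀ _ _
  have h3 : s₀.var 3 = n + 1 := rfl
  have h4 : s₀.var 4 = n := rfl
  have h5 : s₀.var 5 = k - (k - (n + 1)) := rfl
  have ha : ∀ a, a ≠ 0 → ∀ i, s₀.arr a i = 0 := fun a ha i => by
    change (input G k).arr a i = 0
    simp [input, ha]
  refine Total.seq ((Total.multiples h3 h3 (by decide) (ha 1 (by decide) 0)).mono le_rfl ?_)
  rintro s₁ ⟨v₁, a₁, t₁⟩
  refine (Total.multiples ((v₁ 3 (by decide)).trans h3) ((v₁ 4 (by decide)).trans h4) (by decide)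
    (by rw [a₁ 2 (by decide), ha 2 (by decide)])).mono le_rfl ?_
  rintro s₂ ⟨v₂, a₂, t₂⟩
  refine ⟨⟨by rw [v₂ 3 (by decide), v₁ 3 (by decide), h3], fun i hi => ?_⟩,
    by rw [v₂ 4 (by decide), v₁ 4 (by decide), h4],
    by rw [v₂ 5 (by decide), v₁ 5 (by decide), h5], fun u v => ?_⟩
  · rw [a₂ 1 (by decide)]
    exact t₁ i hi.le
  · rw [a₂ 0 (by decide), a₁ 0 (by decide), t₂ u (by nlinarith [u.2])]
    exact input_adj_iff G k u v

variable {G k} in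
open scoped Classical in
/-- The tables are computed correctly, so the answer is the truth value of `φ` in a memory where
array `6` holds the quadruples that can be reached in the prescribed number of steps. -/
theorem decider_total {R : IntervalRep G} (hR : Canonical R) {φ : Form} (hφ : φ.Scoped 0 10)
    {P : Prop} (hP : ∀ s, s.var 3 = n + 1 → s.var 4 = n →
      Holds (n + 1) s 6 (fun x y g f => R.Advances (k - (k - (n + 1))) ⟨x, y, g, f⟩) →
      (φ.Sat s ↔ P)) :
    Total (decider φ) (input G k) (deciderTime φ (n + 1))
      fun s => s.var 0 = if P then 1 else 0 := by
  set K := k - (k - (n + 1)) with hK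
  refine Total.seq ((prepare_total G k).mono le_rfl fun s₁ p₁ => ?_)
  refine Total.seq ((Total.fill (by decide) (by decide) p₁.1).mono le_rfl ?_)
  rintro s₂ ⟨a₂, t₂⟩
  have p₂ : Prepared G K s₂ := p₁.congr (fun i hi => a₂.1 i (by omega))
    fun a ha => a₂.2 a (by omega)
  have c₂ : Holds (n + 1) s₂ 3 (ClassRel G 0) := fun x hx y hy z hz w hw => by
    rw [t₂ x hx y hy z hz w hw, sat_forced_iff p₁]
  refine Total.seq ((Total.iterate_fill (M := n + 1) (N := n + 1) (by decide) (by decide)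
    (by decide) (by decide) (Prepared G K) (ClassRel G)
    (fun s s' hv ha h => h.congr hv fun a h' => ha a (by omega) (by omega))
    (fun s h => h.1) (fun s h => h.1.1)
    (fun t s h hC x hx y hy z hz w hw => sat_square_iff h hC hx hy hz hw) p₂ c₂).mono
    le_rfl ?_)
  rintro s₃ ⟨p₃, c₃⟩
  refine Total.seq ((Total.fill (by decide) (by decide) p₃.1).mono le_rfl ?_)
  rintro s₄ ⟨a₄, t₄⟩
  have p₄ : Prepared G K s₄ := p₃.congr (fun i hi => a₄.1 i (by omega))
    fun a ha => a₄.2 a (by omega)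
  have o₄ : Holds (n + 1) s₄ 5 fun x y _ _ => OrderRel G x y := fun x hx y hy z hz w hw => by
    rw [t₄ x hx y hy z hz w hw, sat_order_iff p₃ c₃ z w hx hy]
  refine Total.seq ((Total.fill (by decide) (by decide) p₄.1).mono le_rfl ?_)
  rintro s₅ ⟨a₅, t₅⟩
  have p₅ : Prepared G K s₅ := p₄.congr (fun i hi => a₅.1 i (by omega))
    fun a ha => a₅.2 a (by omega)
  have o₅ : Holds (n + 1) s₅ 5 fun x y _ _ => OrderRel G x y :=
    o₄.congr (a₅.2 1 (by decide)) (a₅.2 5 (by decide))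
  have c₅ : Holds (n + 1) s₅ 6 fun x y g f => R.Advances 0 ⟨x, y, g, f⟩ :=
    fun x hx y hy z hz w hw => by
      rw [t₅ x hx y hy z hz w hw, sat_start_iff R p₄ hx hy hz hw]
  refine Total.seq ((Total.iterate_fill (M := K) (N := n + 1) (by decide) (by decide)
    (by decide) (by decide)
    (fun s => Prepared G K s ∧ Holds (n + 1) s 5 fun x y _ _ => OrderRel G x y)
    (fun t x y g f => R.Advances t ⟨x, y, g, f⟩)
    (fun s s' hv ha h => ⟨h.1.congr hv fun a h' => ha a (by omega) (by omega),
      h.2.congr (ha 1 (by decide) (by decide)) (ha 5 (by decide) (by decide))⟩)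
    (fun s h => h.1.1) (fun s h => h.1.2.2.1)
    (fun t s h hS x hx y hy g hg f hf => sat_advance_iff hR h.1 h.2 hS hx hy hg hf)
    -- The number of rounds is at most `n + 1`, which makes the time bound independent of `k`.
    ⟨p₅, o₅⟩ c₅).mono (Nat.add_le_add_left (Nat.mul_le_mul_right _ (by omega)) _) ?_)
  rintro s₆ ⟨⟨p₆, -⟩, c₆⟩
  refine Total.seq ((φ.comp_total (d := 10) (by decide) hφ p₆.1.1).mono le_rfl ?_)
  rintro s₇ ⟨-, -, h⟩
  refine Total.assign ?_
  simp only [Expr.eval, State.set_var_same, h]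
  exact if_congr (hP s₆ p₆.1.1 p₆.2.1 c₆) rfl rfl

theorem sat_noFlag_iff {K : ℕ} {R : IntervalRep G} {s : State} (h3 : s.var 3 = n + 1)
    (h4 : s.var 4 = n) (hS : Holds (n + 1) s 6 fun x y g f => R.Advances K ⟨x, y, g, f⟩) :
    Form.noFlag.Sat s ↔ ¬ ∃ q, R.Advances K q ∧ q.y = n ∧ q.f ≠ 0 := by
  simp only [Form.noFlag, Form.Sat, Form.sat_rel, Form.sat_pos, State.set_var, tab_set, h3, h4,
    Nat.reduceEqDiff, reduceIte]
  refine not_congr ⟨?_, ?_⟩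
  · rintro ⟨x, hx, g, hg, f, hf, h, hf0⟩
    exact ⟨_, (hS x hx n (by omega) g hg f hf).1 h, rfl, hf0⟩
  · rintro ⟨⟨x, y, g, f⟩, h, rfl, hf0⟩
    obtain ⟨hx, hy, hg, hf⟩ := h.bounded
    exact ⟨x, hx, g, hg, f, hf, (hS x hx _ hy g hg f hf).2 h, hf0⟩

theorem sat_someBarrier_iff {K : ℕ} {R : IntervalRep G} {s : State} (h3 : s.var 3 = n + 1)
    (h4 : s.var 4 = n) (hS : Holds (n + 1) s 6 fun x y g f => R.Advances K ⟨x, y, g, f⟩) :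
    Form.someBarrier.Sat s ↔ ∃ q, R.Advances K q ∧ q.y = n := by
  simp only [Form.someBarrier, Form.Sat, Form.sat_rel, State.set_var, tab_set, h3, h4,
    Nat.reduceEqDiff, reduceIte]
  constructor
  · rintro ⟨x, hx, g, hg, f, hf, h⟩
    exact ⟨_, (hS x hx n (by omega) g hg f hf).1 h, rfl⟩
  · rintro ⟨⟨x, y, g, f⟩, h, rfl⟩
    obtain ⟨hx, hy, hg, hf⟩ := h.bounded
    exact ⟨x, hx, g, hg, f, hf, (hS x hx _ hy g hg f hf).2 h⟩

end

/-- The canonical representation occurs only in the correctness proof; the program works with the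
order. The two conventions for the empty graph differ only in the final formula. -/
theorem decidableInPolyTime_of_form (φ : Form) (hφ : φ.Scoped 0 10)
    (P : ∀ n : ℕ, SimpleGraph (Fin n) → ℕ → Prop)
    (hP : ∀ (n : ℕ) (G : SimpleGraph (Fin n)) (k : ℕ) (R : IntervalRep G) (s : State),
      s.var 3 = n + 1 → s.var 4 = n →
      Holds (n + 1) s 6 (fun x y g f => R.Advances (k - (k - (n + 1))) ⟨x, y, g, f⟩) →
      (φ.Sat s ↔ P n G k)) :
    DecidableInPolyTime (fun _ G => IsIntervalGraph G) P := by
  classical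
  obtain ⟨b, hb⟩ := (PolyBounded.deciderTime φ).comp_succ
  refine ⟨decider φ, b, ?_⟩
  rintro n G k ⟨R₀⟩
  obtain ⟨R, hR⟩ := exists_rep_lexOrient R₀
  obtain ⟨t, s, hr, ht, hs⟩ := decider_total (k := k) hR hφ (hP n G k R)
  refine ⟨t, s, hr, ht.trans (hb n), fun h => ?_, fun h => ?_⟩
  · rw [hs, if_pos h]
  · rw [hs, if_neg h]

theorem decidable_preconnected :
    DecidableInPolyTime (fun _ G => IsIntervalGraph G) fun _ G k => (TS G k).Preconnected :=
  decidableInPolyTime_of_form Form.noFlag (by decide) _ fun n G k R s h3 h4 hS => by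
    rw [sat_noFlag_iff G h3 h4 hS, ← R.preconnected_iff_advances, preconnected_min_iff]

theorem decidable_connected :
    DecidableInPolyTime (fun _ G => IsIntervalGraph G) fun _ G k => (TS G k).Connected :=
  decidableInPolyTime_of_form (Form.and Form.noFlag Form.someBarrier) (by decide) _
    fun n G k R s h3 h4 hS => by
      rw [Form.Sat, sat_noFlag_iff G h3 h4 hS, sat_someBarrier_iff G h3 h4 hS,
        ← R.preconnected_iff_advances, preconnected_min_iff, ← R.nonempty_iff_advances,
        nonempty_min_iff, SimpleGraph.connected_iff]

end TokenSliding

open TokenSliding in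
theorem theorem2 :
    -- the connectivity of `TS_k(G)` can be decided in polynomial time, ...
    DecidableInPolyTime (fun _ G => IsIntervalGraph G) (fun _ G k => (TS G k).Connected) ∧
    -- ... also if the graph without vertices counts as connected
    DecidableInPolyTime (fun _ G => IsIntervalGraph G) (fun _ G k => (TS G k).Preconnected) ∧
    -- the criterion in terms of the worst l-indices and the leftmost independent set `L`
    ∀ (V : Type*) [Finite V] (G : SimpleGraph V) (R : IntervalRep G) (_ : R.Distinct) (k : ℕ)
      (L : List V) (_ : LeftmostList R.l R.r Set.univ L),
      (TS G k).Preconnected ↔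
        ∀ i ≤ k, i ≤ L.length → ∀ a x : rightOf R.l R.r L i,
          IsWorstL (G.induce (rightOf R.l R.r L i)) (fun v => R.r v) (k - i) a x →
            L[i]? = some x.val := by
  exact ⟨decidable_connected, decidable_preconnected, fun V _ G R hR k _ hL =>
    R.preconnected_iff_isWorstL hR k hL⟩
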